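/- Let $4\le n<6$ be real and consider the degenerate dispersive equation $\phi_t+(\phi^n)_z-\left(\phi^n\left(\phi^{-m}\phi_t\right)_z\right)_z=0$ on $z\in\mathbb R$, $t\ge 0$, with $m=0$. For $\phi>0$ with $\phi-1\in H^1(\mathbb R)$ put $L_\phi u=-(\phi^n u_z)_z+\phi^m u$. The function $L_\phi^{-1}[-(\phi^n)_z]$ is the weak solution $u\in H^1(\mathbb R)$ of $L_\phi u=-(\phi^n)_z$. A global $H^1$ solution with data $\phi_0$ is a function $\phi>0$ with $\phi-1\in C^1([0,\infty);H^1(\mathbb R))$ and $$\phi(\cdot,t)=\phi_0+\int_0^t\phi(\cdot,s)^m\,L_{\phi(\cdot,s)}^{-1}\left[-(\phi(\cdot,s)^n)_z\right]ds\qquad(t\ge 0).$$ Then, with $m=0$, the problem is globally well-posed in the following sense. 1. (Existence and uniqueness.) For every $\phi_0$ with $\phi_0-1\in H^1(\mathbb R)$ and $\|1/\phi_0\|_{L^\infty}<\infty$ there is exactly one global $H^1$ solution $\phi$ with data $\phi_0$. Moreover $\sup_{t\ge 0}\|1/\phi(\cdot,t)\|_{L^\infty}<\infty$. 2. (Continuous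 dependence.) For all real $R,K$ there is a constant $C=C(R,K,n)$ such that, if $\phi,\psi$ are global $H^1$ solutions whose data $\phi_0,\psi_0$ satisfy $\|\phi_0-1\|_{H^1},\|\psi_0-1\|_{H^1}\le R$ and $\|1/\phi_0\|_{L^\infty},\|1/\psi_0\|_{L^\infty}\le K$, then $$\|\phi(\cdot,t)-\psi(\cdot,t)\|_{H^1}\le \|\phi_0-\psi_0\|_{H^1}\,e^{Ct}\qquad(t\ge 0).$$ -/

import Mathlib

open MeasureTheory Set
open scoped ENNReal ContDiff

noncomputable section

namespace Magma

/-- Real-valued `L²(ℝ)` for Lebesgue measure. -/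
abbrev L2 : Type := Lp ℝ 2 (volume : Measure ℝ)

/-- `g` is the weak derivative of `f`: `∫ f η' = - ∫ g η` for all smooth compactly supported `η`. -/
def IsWeakDeriv (f g : ℝ → ℝ) : Prop :=
  ∀ η : ℝ → ℝ, ContDiff ℝ ∞ η → HasCompactSupport η →
    ∫ z, f z * deriv η z = - ∫ z, g z * η z

theorem memLp_test {η : ℝ → ℝ} (h : ContDiff ℝ ∞ η) (hc : HasCompactSupport η) :
    MemLp η 2 (volume : Measure ℝ) :=
  h.continuous.memLp_of_hasCompactSupport hc

theorem memLp_deriv_test {η : ℝ → ℝ} (h : ContDiff ℝ ∞ η) (hc : HasCompactSupport η) :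
    MemLp (deriv η) 2 (volume : Measure ℝ) :=
  (h.continuous_deriv (by simp)).memLp_of_hasCompactSupport hc.deriv

theorem integral_mul_eq_inner {η : ℝ → ℝ} (hη : MemLp η 2 (volume : Measure ℝ)) (f : L2) :
    ∫ z, f z * η z = inner ℝ (hη.toLp η) f := by
  rw [L2.inner_def]
  refine integral_congr_ae ?_
  filter_upwards [hη.coeFn_toLp] with z hz
  simp [hz]

theorem isWeakDeriv_iff (f g : L2) :
    IsWeakDeriv f g ↔ ∀ (η : ℝ → ℝ) (h : ContDiff ℝ ∞ η) (hc : HasCompactSupport η),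
      inner ℝ ((memLp_deriv_test h hc).toLp (deriv η)) f
        = - inner ℝ ((memLp_test h hc).toLp η) g := by
  constructor
  · intro H η h hc
    rw [← integral_mul_eq_inner, ← integral_mul_eq_inner]
    exact H η h hc
  · intro H η h hc
    rw [integral_mul_eq_inner (memLp_deriv_test h hc), integral_mul_eq_inner (memLp_test h hc)]
    exact H η h hc

/-- The graph of the weak derivative in `L² × L²`: pairs `(f, f')`. -/
def h1Submodule : Submodule ℝ (WithLp 2 (L2 × L2)) where
  carrier := {p | IsWeakDeriv p.fst p.snd}
  add_mem' := by
    intro p q hp hq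
    simp only [mem_ofPred_eq, isWeakDeriv_iff] at hp hq ⊢
    intro η h hc
    simp only [WithLp.add_fst, WithLp.add_snd, inner_add_right, hp η h hc, hq η h hc]
    ring
  zero_mem' := by
    simp only [mem_ofPred_eq, isWeakDeriv_iff]
    intro η h hc
    simp
  smul_mem' := by
    intro c p hp
    simp only [mem_ofPred_eq, isWeakDeriv_iff] at hp ⊢
    intro η h hc
    simp only [WithLp.smul_fst, WithLp.smul_snd, inner_smul_right, hp η h hc]
    ring

/-- The Sobolev space `H¹(ℝ) = W^{1,2}(ℝ)`: an element is a function `f ∈ L²` together with its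
(unique) weak derivative `f' ∈ L²`, and `‖f‖² = ‖f‖²_{L²} + ‖f'‖²_{L²}`. -/
abbrev H1 : Type := h1Submodule

/-- The underlying function of an element of `H¹` (defined up to null sets). -/
def H1.fn (w : H1) : ℝ → ℝ := w.1.fst

/-- The weak derivative of an element of `H¹`. -/
def H1.wderiv (w : H1) : ℝ → ℝ := w.1.snd

theorem H1.norm_sq (w : H1) :
    ‖w‖ ^ 2 = ∫ z, w.fn z ^ 2 + w.wderiv z ^ 2 := by
  have key : ∀ f : L2, ‖f‖ ^ 2 = ∫ z, f z ^ 2 := by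
    intro f
    rw [← real_inner_self_eq_norm_sq, L2.inner_def]
    refine integral_congr_ae (Filter.Eventually.of_forall fun z => ?_)
    simp [pow_two]
  rw [integral_add]
  · exact (WithLp.prod_norm_sq_eq_of_L2 w.1).trans (by rw [key, key]; rfl)
  · exact (Lp.memLp w.1.fst).integrable_sq
  · exact (Lp.memLp w.1.snd).integrable_sq

theorem isClosed_h1Submodule : IsClosed (h1Submodule : Set (WithLp 2 (L2 × L2))) := by
  have : (h1Submodule : Set (WithLp 2 (L2 × L2))) =
      ⋂ (η : ℝ → ℝ) (h : ContDiff ℝ ∞ η) (hc : HasCompactSupport η),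
        {p : WithLp 2 (L2 × L2) | inner ℝ ((memLp_deriv_test h hc).toLp (deriv η)) p.fst
          = - inner ℝ ((memLp_test h hc).toLp η) p.snd} := by
    ext p
    simp only [mem_iInter, mem_ofPred_eq]
    exact isWeakDeriv_iff p.fst p.snd
  rw [this]
  refine isClosed_iInter fun η => isClosed_iInter fun h => isClosed_iInter fun hc => ?_
  have h1 : Continuous fun p : WithLp 2 (L2 × L2) => p.fst :=
    (WithLp.prod_continuous_ofLp 2 L2 L2).fst
  have h2 : Continuous fun p : WithLp 2 (L2 × L2) => p.snd :=
    (WithLp.prod_continuous_ofLp 2 L2 L2).snd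
  exact isClosed_eq (continuous_const.inner h1) (continuous_const.inner h2).neg

instance : CompleteSpace H1 := isClosed_h1Submodule.completeSpace_coe

/-- The porosity `φ = 1 + w` described by the perturbation `w = φ - 1 ∈ H¹(ℝ)`. -/
def porosity (w : H1) : ℝ → ℝ := fun z => 1 + w.fn z

/-- With `φ = 1 + w`, `u ∈ H¹` is the weak solution of
`L_φ u = -(φⁿ u_z)_z + φᵐ u = -(φⁿ)_z`, i.e.
`∫ φⁿ u_z V_z + φᵐ u V = ∫ (φⁿ - 1) V_z` for all `V ∈ H¹(ℝ)`. The constant `1` has zero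
derivative; it is subtracted because `φⁿ - 1`, unlike `φⁿ`, lies in `L²(ℝ)`. -/
def IsEllipticSolution (n m : ℝ) (w u : H1) : Prop :=
  ∀ V : H1,
    ∫ z, (porosity w z ^ n * u.wderiv z * V.wderiv z + porosity w z ^ m * u.fn z * V.fn z)
      = ∫ z, (porosity w z ^ n - 1) * V.wderiv z

/-- `φ(·,t) = 1 + w t`, `t ≥ 0`, is a global `H¹` solution of
`(φᵐ - ∂_z φⁿ ∂_z)[φ^{-m} φ_t] = -(φⁿ)_z` with data `φ₀ = 1 + w₀`: `φ > 0`,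
`φ - 1 ∈ C¹([0,∞); H¹(ℝ))`, and `φ(t) = φ₀ + ∫₀ᵗ φᵐ L_φ⁻¹[-(φⁿ)_z] ds`
(a Bochner integral in `H¹`, with integrand `q s = φ(s)ᵐ u(s)`). -/
structure IsGlobalSolution (n m : ℝ) (w₀ : H1) (w : ℝ → H1) : Prop where
  pos : ∀ t, 0 ≤ t → ∀ᵐ z, 0 < porosity (w t) z
  contDiffOn : ContDiffOn ℝ 1 w (Ici 0)
  fixedPoint : ∃ u q : ℝ → H1,
    (∀ t, 0 ≤ t → IsEllipticSolution n m (w t) (u t)) ∧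
    (∀ t, 0 ≤ t → (q t).fn =ᵐ[volume] fun z => porosity (w t) z ^ m * (u t).fn z) ∧
    (∀ t, 0 ≤ t → IntervalIntegrable q volume 0 t) ∧
    (∀ t, 0 ≤ t → w t = w₀ + ∫ s in (0 : ℝ)..t, q s)

/-- `‖1/φ‖_{L^∞}` for `φ = 1 + w`, the essential supremum of `1/|φ|` in `[0,∞]`,
where `1/0 = ∞`. -/
def invSup (w : H1) : ℝ≥0∞ := essSup (fun z => ‖porosity w z‖ₑ⁻¹) volume

end Magma

end

/-! For m = 0 the problem is the ordinary differential equation w' = u(w) in H¹, with w = φ - 1 and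
u(w) the solution of -(φⁿ u_z)_z + u = -(φⁿ)_z. The difficulty is that φⁿ may degenerate or blow up.

Replace φⁿ by a(w), where φ is truncated to [c, M]. Lax-Milgram then gives a velocity that is
Lipschitz on bounded sets of H¹, and multiplying it by a cutoff in ‖w‖ gives a bounded, globally
Lipschitz field, hence a global flow. Let Φ'' = 1/a with Φ(0) = Φ'(0) = 0. Testing the elliptic
equation with Φ'(w) shows that the flow conserves ½‖w_z‖² + ∫ Φ(w). For data in a fixed class this
energy is at most some E that does not depend on c and M.

The energy controls w pointwise by the Modica-Mortola inequality: if G' = √(2Φ) and G(0) = 0, then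
|G(w)| is at most the energy. For n ≥ 4 the function √(2Φ) is at least of order 1/φ near φ = 0, so G
falls at least logarithmically there (`barrier_truncPow_lower`); for large φ it grows linearly.
Hence c and M can be chosen from E so that neither truncation is ever reached (`exists_truncation`),
and the energy also bounds ‖w‖, so the cutoff is inactive as well. The flow therefore solves the
original problem.

Any other solution with the same data agrees with the flow by continuation in time
(`IsGlobalSolution.eq_flow`). All data of a class share one Lipschitz field, so Grönwall's
inequality gives continuous dependence. -/

noncomputable section

open Filter Topology
open scoped BoundedContinuousFunction NNReal

namespace Magma

/-! ### Locally absolutely continuous functions on the line -/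

/-- `f` is a locally absolutely continuous function with derivative `g`. -/
structure IsPrimitive (f g : ℝ → ℝ) : Prop where
  locallyIntegrable : LocallyIntegrable g volume
  sub_eq : ∀ a b, f b - f a = ∫ x in a..b, g x

theorem _root_.MeasureTheory.LocallyIntegrable.intervalIntegrable {g : ℝ → ℝ}
    (hg : LocallyIntegrable g volume) (a b : ℝ) : IntervalIntegrable g volume a b :=
  intervalIntegrable_iff.mpr <|
    (hg.integrableOn_isCompact isCompact_uIcc).mono_set uIoc_subset_uIcc

theorem _root_.AbsolutelyContinuousOnInterval.lipschitzOnWith_comp {f k : ℝ → ℝ} {a b : ℝ}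
    {K : NNReal} (hf : AbsolutelyContinuousOnInterval f a b)
    (hk : LipschitzOnWith K k (f '' uIcc a b)) :
    AbsolutelyContinuousOnInterval (fun x => k (f x)) a b := by
  rw [absolutelyContinuousOnInterval_iff] at hf ⊢
  intro ε hε
  -- The added 1 covers K = 0 and makes the final inequality strict.
  obtain ⟨δ, hδ, h⟩ := hf (ε / (K + 1)) (by positivity)
  refine ⟨δ, hδ, fun E hE hlen => ?_⟩
  have h1 := h E hE hlen
  calc ∑ i ∈ Finset.range E.1, dist (k (f (E.2 i).1)) (k (f (E.2 i).2))
      ≤ ∑ i ∈ Finset.range E.1, K * dist (f (E.2 i).1) (f (E.2 i).2) := by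
        refine Finset.sum_le_sum fun i hi => ?_
        exact hk.dist_le_mul _ (mem_image_of_mem f (hE.1 i hi).1) _
          (mem_image_of_mem f (hE.1 i hi).2)
    _ = K * ∑ i ∈ Finset.range E.1, dist (f (E.2 i).1) (f (E.2 i).2) := by
        rw [Finset.mul_sum]
    _ ≤ K * (ε / (K + 1)) := by gcongr
    _ < (K + 1) * (ε / (K + 1)) := by gcongr; linarith
    _ = ε := by field_simp

namespace IsPrimitive

variable {f g : ℝ → ℝ}

theorem eq_add (h : IsPrimitive f g) (a x : ℝ) : f x = f a + ∫ t in a..x, g t := by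
  rw [← h.sub_eq a x]; ring

theorem absolutelyContinuous (h : IsPrimitive f g) (a b : ℝ) :
    AbsolutelyContinuousOnInterval f a b := by
  have h1 := (h.locallyIntegrable.intervalIntegrable a b)
    |>.absolutelyContinuousOnInterval_intervalIntegral (c := a) (by simp)
  have h2 : AbsolutelyContinuousOnInterval (fun _ : ℝ => f a) a b :=
    (contDiff_const.contDiffOn (n := 1)).absolutelyContinuousOnInterval
  have : f = (fun _ => f a) + fun x => ∫ t in a..x, g t := by
    ext x; exact h.eq_add a x
  rw [this]
  exact h2.add h1

theorem ae_hasDerivAt (h : IsPrimitive f g) : ∀ᵐ x, HasDerivAt f (g x) x := by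
  filter_upwards [_root_.LocallyIntegrable.ae_hasDerivAt_integral h.locallyIntegrable] with x hx
  have := (hx 0).const_add (f 0)
  convert! this using 1
  ext y; exact h.eq_add 0 y

/-- The fundamental theorem of calculus for absolutely continuous functions. It reduces the chain
and product rules below to their pointwise versions almost everywhere. -/
theorem of_absolutelyContinuous (hf : ∀ a b, AbsolutelyContinuousOnInterval f a b)
    (hg : LocallyIntegrable g volume) (h : ∀ᵐ x, HasDerivAt f (g x) x) : IsPrimitive f g where
  locallyIntegrable := hg
  sub_eq a b := by
    rw [← (hf a b).integral_deriv_eq_sub]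
    refine intervalIntegral.integral_congr_ae ?_
    filter_upwards [h] with x hx _
    exact hx.deriv

theorem continuous (h : IsPrimitive f g) : Continuous f := by
  have : f = fun x => f 0 + ∫ t in (0 : ℝ)..x, g t := by
    ext x; exact h.eq_add 0 x
  rw [this]
  exact continuous_const.add
    (intervalIntegral.continuous_primitive h.locallyIntegrable.intervalIntegrable 0)

theorem comp (h : IsPrimitive f g) {k k' : ℝ → ℝ} (hk : ∀ s, HasDerivAt k (k' s) s)
    (hk' : Continuous k') : IsPrimitive (fun x => k (f x)) (fun x => k' (f x) * g x) := by
  have hC : ContDiff ℝ 1 k := by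
    rw [contDiff_one_iff_deriv]
    refine ⟨fun s => (hk s).differentiableAt, ?_⟩
    rwa [funext fun s => (hk s).deriv]
  refine of_absolutelyContinuous (fun a b => ?_) ?_ ?_
  · obtain ⟨m, M, hmM⟩ : ∃ m M, f '' uIcc a b ⊆ Icc m M := by
      obtain ⟨m, hm⟩ := (isCompact_uIcc (a := a) (b := b)).bddBelow_image h.continuous.continuousOn
      obtain ⟨M, hM⟩ := (isCompact_uIcc (a := a) (b := b)).bddAbove_image h.continuous.continuousOn
      exact ⟨m, M, fun y hy => ⟨hm hy, hM hy⟩⟩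
    obtain ⟨K, hK⟩ := hC.contDiffOn.exists_lipschitzOnWith (by decide) (convex_Icc m M)
      isCompact_Icc
    exact (h.absolutelyContinuous a b).lipschitzOnWith_comp (hK.mono hmM)
  · exact h.locallyIntegrable.continuous_mul (hk'.comp h.continuous)
  · filter_upwards [h.ae_hasDerivAt] with x hx
    exact (hk (f x)).comp x hx

theorem mul {f₁ g₁ : ℝ → ℝ} (h : IsPrimitive f g) (h₁ : IsPrimitive f₁ g₁) :
    IsPrimitive (fun x => f x * f₁ x) (fun x => g x * f₁ x + f x * g₁ x) := by
  refine of_absolutelyContinuous (fun a b => ?_) ?_ ?_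
  · exact (h.absolutelyContinuous a b).mul (h₁.absolutelyContinuous a b)
  · exact (h.locallyIntegrable.mul_continuous h₁.continuous).add
      (h₁.locallyIntegrable.continuous_mul h.continuous)
  · filter_upwards [h.ae_hasDerivAt, h₁.ae_hasDerivAt] with x hx hx₁
    exact hx.mul hx₁

theorem of_contDiff {η : ℝ → ℝ} (h : ContDiff ℝ 1 η) : IsPrimitive η (deriv η) :=
  of_absolutelyContinuous (fun _ _ => h.contDiffOn.absolutelyContinuousOnInterval)
    (h.continuous_deriv le_rfl).locallyIntegrable
    (Eventually.of_forall fun x => (h.differentiable (by simp) x).hasDerivAt)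

theorem abs_sub_le (h : IsPrimitive f g) (hg : Integrable g) (x y : ℝ) :
    |f y - f x| ≤ ∫ z, |g z| := by
  rw [h.sub_eq, ← Real.norm_eq_abs]
  refine (intervalIntegral.norm_integral_le_integral_norm_uIoc).trans ?_
  exact setIntegral_le_integral hg.norm (Eventually.of_forall fun z => norm_nonneg _)

theorem tendsto_atTop (h : IsPrimitive f g) (hg : Integrable g) :
    Tendsto f atTop (𝓝 (f 0 + ∫ x in Ioi 0, g x)) := by
  have : f = fun x => f 0 + ∫ t in (0 : ℝ)..x, g t := by
    ext x; exact h.eq_add 0 x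
  nth_rw 1 [this]
  exact tendsto_const_nhds.add
    (intervalIntegral_tendsto_integral_Ioi 0 hg.integrableOn tendsto_id)

theorem tendsto_atBot (h : IsPrimitive f g) (hg : Integrable g) :
    Tendsto f atBot (𝓝 (f 0 - ∫ x in Iic 0, g x)) := by
  have : f = fun x => f 0 - ∫ t in x..(0 : ℝ), g t := by
    ext x; rw [← h.sub_eq x 0]; ring
  nth_rw 1 [this]
  exact tendsto_const_nhds.sub
    (intervalIntegral_tendsto_integral_Iic 0 hg.integrableOn tendsto_id)

end IsPrimitive

/-- A nonzero limit would keep |f| ≥ |c|/2 on a set of infinite measure, against Chebyshev's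
inequality. -/
theorem eq_zero_of_tendsto_of_memLp {f : ℝ → ℝ} {p : ℝ≥0∞} (hp : p ≠ 0) (hp' : p ≠ ⊤)
    (hf : MemLp f p volume) {l : Filter ℝ} (hl : ∀ s ∈ l, volume s = ⊤) {c : ℝ}
    (h : Tendsto f l (𝓝 c)) : c = 0 := by
  by_contra hc
  have hc' : 0 < |c| / 2 := by positivity
  have hev : ∀ᶠ x in l, |c| / 2 ≤ ‖f x‖ := by
    have h1 : Tendsto (fun x => ‖f x‖) l (𝓝 |c|) := h.norm
    exact h1.eventually (eventually_ge_nhds (by linarith))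
  have h2 := hf.meas_ge_lt_top hp hp' (ε := ⟨|c| / 2, hc'.le⟩) (by
    intro h0; exact hc'.ne' (congrArg NNReal.toReal h0))
  have h3 : {x | |c| / 2 ≤ ‖f x‖} = {x | (⟨|c| / 2, hc'.le⟩ : NNReal) ≤ ‖f x‖₊} := by
    ext x; exact Iff.rfl
  have h4 := hl _ hev
  change volume {x | |c| / 2 ≤ ‖f x‖} = ⊤ at h4
  rw [h3] at h4
  exact h2.ne h4

theorem volume_eq_top_of_mem_atTop (s : Set ℝ) (hs : s ∈ (atTop : Filter ℝ)) :
    volume s = ⊤ := by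
  obtain ⟨a, ha⟩ := mem_atTop_sets.1 hs
  have := measure_mono (μ := volume) (show Ici a ⊆ s from ha)
  simpa using this

theorem volume_eq_top_of_mem_atBot (s : Set ℝ) (hs : s ∈ (atBot : Filter ℝ)) :
    volume s = ⊤ := by
  obtain ⟨a, ha⟩ := mem_atBot_sets.1 hs
  have := measure_mono (μ := volume) (show Iic a ⊆ s from ha)
  simpa using this

namespace IsPrimitive

variable {f g : ℝ → ℝ} {p : ℝ≥0∞}

theorem tendsto_zero_atTop (h : IsPrimitive f g) (hg : Integrable g) (hp : p ≠ 0) (hp' : p ≠ ⊤)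
    (hf : MemLp f p volume) : Tendsto f atTop (𝓝 0) := by
  have h1 := h.tendsto_atTop hg
  rwa [eq_zero_of_tendsto_of_memLp hp hp' hf volume_eq_top_of_mem_atTop h1] at h1

theorem abs_le (h : IsPrimitive f g) (hg : Integrable g) (hp : p ≠ 0) (hp' : p ≠ ⊤)
    (hf : MemLp f p volume) (x : ℝ) : |f x| ≤ ∫ z, |g z| := by
  have h1 : Tendsto (fun y => |f y - f x|) atTop (𝓝 |0 - f x|) :=
    ((h.tendsto_zero_atTop hg hp hp' hf).sub_const _).abs
  have := le_of_tendsto' h1 fun y => h.abs_sub_le hg x y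
  simpa using this

theorem integral_eq_zero (h : IsPrimitive f g) (hg : Integrable g) (hp : p ≠ 0) (hp' : p ≠ ⊤)
    (hf : MemLp f p volume) : ∫ z, g z = 0 := by
  have h1 := eq_zero_of_tendsto_of_memLp hp hp' hf volume_eq_top_of_mem_atTop
    (h.tendsto_atTop hg)
  have h2 := eq_zero_of_tendsto_of_memLp hp hp' hf volume_eq_top_of_mem_atBot
    (h.tendsto_atBot hg)
  rw [← intervalIntegral.integral_Iic_add_Ioi (b := 0) hg.integrableOn hg.integrableOn]
  linarith

/-- Integration by parts: the product with a test function is again a primitive and vanishes at both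
ends, so its derivative has integral zero. -/
theorem isWeakDeriv (h : IsPrimitive f g) : IsWeakDeriv f g := by
  intro η hη hc
  have hp := h.mul (of_contDiff (hη.of_le (by simp)))
  have hd : Continuous (deriv η) := hη.continuous_deriv (by simp)
  have i1 : Integrable fun x => g x * η x :=
    h.locallyIntegrable.integrable_smul_right_of_hasCompactSupport hη.continuous hc
  have i2 : Integrable fun x => f x * deriv η x :=
    (h.continuous.mul hd).integrable_of_hasCompactSupport hc.deriv.mul_left
  have h0 := hp.integral_eq_zero (p := 1) (i1.add i2) one_ne_zero ENNReal.one_ne_top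
    (memLp_one_iff_integrable.2
      ((h.continuous.mul hη.continuous).integrable_of_hasCompactSupport hc.mul_left))
  rw [integral_add i1 i2] at h0
  linarith

end IsPrimitive

/-! ### Functions with vanishing weak derivative -/

/-- The primitive started to the left of the support equals the total integral, which is zero, to
the right of it. -/
theorem exists_hasCompactSupport_deriv_eq {θ : ℝ → ℝ} (hθ : ContDiff ℝ ∞ θ)
    (hc : HasCompactSupport θ) (h0 : ∫ x, θ x = 0) :
    ∃ Θ : ℝ → ℝ, ContDiff ℝ ∞ Θ ∧ HasCompactSupport Θ ∧ deriv Θ = θ := by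
  obtain ⟨R, hR⟩ : ∃ R : ℝ, Function.support θ ⊆ Ioc (-R) R := by
    obtain ⟨R, hR⟩ := hc.isCompact.isBounded.subset_closedBall 0
    rw [Real.closedBall_eq_Icc, zero_sub, zero_add] at hR
    refine ⟨R + 1, ((subset_tsupport _).trans hR).trans fun x hx => ⟨?_, ?_⟩⟩
    · linarith [hx.1]
    · linarith [hx.2]
  have hθ0 : ∀ x, x ∉ Ioc (-R) R → θ x = 0 := fun x hx => by
    by_contra h
    exact hx (hR h)
  have hd : ∀ x, HasDerivAt (fun x => ∫ t in (-R)..x, θ t) (θ x) x := fun x =>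
    intervalIntegral.integral_hasDerivAt_right (hθ.continuous.intervalIntegrable _ _)
      (hθ.continuous.stronglyMeasurableAtFilter _ _) hθ.continuous.continuousAt
  have hderiv : deriv (fun x => ∫ t in (-R)..x, θ t) = θ := funext fun x => (hd x).deriv
  refine ⟨fun x => ∫ t in (-R)..x, θ t, ?_, ?_, hderiv⟩
  · rw [contDiff_infty_iff_deriv, hderiv]
    exact ⟨fun x => (hd x).differentiableAt, hθ⟩
  · refine HasCompactSupport.of_support_subset_isCompact (isCompact_Icc (a := -R) (b := R)) ?_
    intro x hx
    by_contra hxR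
    refine hx ?_
    rw [mem_Icc, not_and_or, not_le, not_le] at hxR
    rcases hxR with hxR | hxR
    · change ∫ t in (-R)..x, θ t = 0
      refine intervalIntegral.integral_zero_ae (Eventually.of_forall fun t ht => hθ0 t ?_)
      rw [uIoc_of_ge hxR.le] at ht
      exact fun h => h.1.not_ge ht.2
    · change ∫ t in (-R)..x, θ t = 0
      rw [intervalIntegral.integral_eq_integral_of_support_subset
        (hR.trans (Ioc_subset_Ioc_right hxR.le)), h0]

/-- The du Bois-Reymond lemma. -/
theorem IsWeakDeriv.ae_eq_const {f : ℝ → ℝ} (hf : LocallyIntegrable f volume)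
    (h : IsWeakDeriv f 0) : ∃ c : ℝ, f =ᵐ[volume] fun _ => c := by
  let b : ContDiffBump (0 : ℝ) := default
  let η := b.normed volume
  have hη : ContDiff ℝ ∞ η := b.contDiff_normed
  have hηc : HasCompactSupport η := b.hasCompactSupport_normed
  -- Since η has integral 1, ψ - (∫ψ)η has mean zero and is the derivative of a test function; f
  -- integrates to zero against it, which singles out ∫ f η as the constant.
  refine ⟨∫ x, f x * η x, ?_⟩
  refine ae_eq_of_integral_contDiff_smul_eq hf (locallyIntegrable_const _) fun ψ hψ hψc => ?_
  have i1 : Integrable fun x => f x * ψ x :=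
    hf.integrable_smul_right_of_hasCompactSupport hψ.continuous hψc
  have i2 : Integrable fun x => f x * η x :=
    hf.integrable_smul_right_of_hasCompactSupport hη.continuous hηc
  have hint : ∫ x, (ψ x - (∫ y, ψ y) * η x) = 0 := by
    rw [integral_sub (hψ.continuous.integrable_of_hasCompactSupport hψc)
      ((hη.continuous.integrable_of_hasCompactSupport hηc).const_mul _), integral_const_mul,
      b.integral_normed]
    ring
  obtain ⟨Θ, hΘ, hΘc, hΘd⟩ := exists_hasCompactSupport_deriv_eq
    (hψ.sub (contDiff_const.mul hη)) (hψc.sub hηc.mul_left) hint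
  have key := h Θ hΘ hΘc
  rw [hΘd] at key
  simp only [Pi.zero_apply, zero_mul, integral_zero, neg_zero, mul_sub] at key
  rw [integral_sub i1 (by convert i2.const_mul (∫ y, ψ y) using 2; ring)] at key
  simp only [smul_eq_mul, integral_mul_const]
  have e1 : ∫ x, f x * ((∫ y, ψ y) * η x) = (∫ y, ψ y) * ∫ x, f x * η x := by
    rw [← integral_const_mul]; congr 1; ext x; ring
  have e2 : ∫ x, ψ x * f x = ∫ x, f x * ψ x := by congr 1; ext x; ring
  rw [e2]; linarith

/-! ### The space H¹(ℝ): continuous representatives, sup bound, chain rule -/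

theorem L2.norm_sq_eq_integral (f : L2) : ‖f‖ ^ 2 = ∫ z, f z ^ 2 := by
  rw [← real_inner_self_eq_norm_sq, L2.inner_def]
  refine integral_congr_ae (Eventually.of_forall fun z => ?_)
  simp [pow_two]

theorem L2.inner_eq_integral (f g : L2) : inner ℝ f g = ∫ z, f z * g z := by
  rw [L2.inner_def]
  refine integral_congr_ae (Eventually.of_forall fun z => ?_)
  simp [mul_comm]

theorem L2.integrable_mul (f g : L2) : Integrable fun z => f z * g z :=
  (Lp.memLp f).integrable_mul (Lp.memLp g)

namespace H1

/-- The inclusion `H¹ → L²`. -/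
def fnL : H1 →L[ℝ] L2 :=
  (ContinuousLinearMap.fst ℝ L2 L2).comp
    ((WithLp.prodContinuousLinearEquiv 2 ℝ L2 L2).toContinuousLinearMap.comp h1Submodule.subtypeL)

/-- The weak derivative as an operator `H¹ → L²`. -/
def derivL : H1 →L[ℝ] L2 :=
  (ContinuousLinearMap.snd ℝ L2 L2).comp
    ((WithLp.prodContinuousLinearEquiv 2 ℝ L2 L2).toContinuousLinearMap.comp h1Submodule.subtypeL)

theorem fn_eq (w : H1) : w.fn = fnL w := rfl

theorem wderiv_eq (w : H1) : w.wderiv = derivL w := rfl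

theorem inner_eq (w v : H1) :
    inner ℝ w v = inner ℝ (fnL w) (fnL v) + inner ℝ (derivL w) (derivL v) :=
  WithLp.prod_inner_apply w.1 v.1

theorem norm_sq_eq (w : H1) : ‖w‖ ^ 2 = ‖fnL w‖ ^ 2 + ‖derivL w‖ ^ 2 := by
  simp only [← real_inner_self_eq_norm_sq, inner_eq]

theorem norm_fnL_le (w : H1) : ‖fnL w‖ ≤ ‖w‖ := by
  have := norm_sq_eq w
  exact le_of_sq_le_sq (by nlinarith [sq_nonneg ‖derivL w‖]) (norm_nonneg _)

theorem norm_derivL_le (w : H1) : ‖derivL w‖ ≤ ‖w‖ := by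
  have := norm_sq_eq w
  exact le_of_sq_le_sq (by nlinarith [sq_nonneg ‖fnL w‖]) (norm_nonneg _)

/-- The difference between `w.fn` and a primitive of its weak derivative has zero weak derivative,
so it is constant by du Bois-Reymond. -/
theorem exists_isPrimitive (w : H1) :
    ∃ f : ℝ → ℝ, IsPrimitive f w.wderiv ∧ f =ᵐ[volume] w.fn := by
  have hloc : LocallyIntegrable w.wderiv volume :=
    (Lp.memLp (derivL w)).locallyIntegrable (by norm_num)
  have hloc' : LocallyIntegrable w.fn volume :=
    (Lp.memLp (fnL w)).locallyIntegrable (by norm_num)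
  let v : ℝ → ℝ := fun x => ∫ t in (0 : ℝ)..x, w.wderiv t
  have hv : IsPrimitive v w.wderiv := ⟨hloc, fun a b => by
    simp only [v]
    rw [← intervalIntegral.integral_add_adjacent_intervals (hloc.intervalIntegrable 0 a)
      (hloc.intervalIntegrable a b)]
    ring⟩
  have hweak : IsWeakDeriv (fun x => w.fn x - v x) 0 := by
    intro η hη hc
    have h1 := w.2 η hη hc
    have h2 := hv.isWeakDeriv η hη hc
    have hd : Continuous (deriv η) := hη.continuous_deriv (by simp)
    simp only [Pi.zero_apply, zero_mul, integral_zero, neg_zero, sub_mul]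
    have i1 : Integrable fun z => w.fn z * deriv η z :=
      hloc'.integrable_smul_right_of_hasCompactSupport hd hc.deriv
    have i2 : Integrable fun z => v z * deriv η z :=
      hv.continuous.locallyIntegrable.integrable_smul_right_of_hasCompactSupport hd hc.deriv
    rw [integral_sub i1 i2]
    exact sub_eq_zero.2 (h1.trans h2.symm)
  obtain ⟨c, hc⟩ := hweak.ae_eq_const (hloc'.sub hv.continuous.locallyIntegrable)
  refine ⟨fun x => v x + c, ⟨hloc, fun a b => by rw [← hv.sub_eq]; ring⟩, ?_⟩
  filter_upwards [hc] with x hx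
  rw [Pi.sub_apply] at hx
  linarith

/-- The continuous representative of an element of `H¹(ℝ)`. -/
def rep (w : H1) : ℝ → ℝ := w.exists_isPrimitive.choose

theorem isPrimitive_rep (w : H1) : IsPrimitive w.rep w.wderiv :=
  w.exists_isPrimitive.choose_spec.1

theorem rep_ae_eq (w : H1) : w.rep =ᵐ[volume] w.fn :=
  w.exists_isPrimitive.choose_spec.2

theorem continuous_rep (w : H1) : Continuous w.rep := w.isPrimitive_rep.continuous

theorem rep_eq_of_ae_eq {w : H1} {f : ℝ → ℝ} (hf : Continuous f) (h : w.fn =ᵐ[volume] f) :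
    w.rep = f :=
  (w.continuous_rep.ae_eq_iff_eq volume hf).1 (w.rep_ae_eq.trans h)

theorem memLp_rep (w : H1) : MemLp w.rep 2 volume :=
  (memLp_congr_ae w.rep_ae_eq).2 (Lp.memLp (fnL w))

theorem memLp_wderiv (w : H1) : MemLp w.wderiv 2 volume := Lp.memLp (derivL w)

/-- The second component of an element of the graph is determined by the first: both derivatives are
the pointwise derivative of the common continuous representative. -/
theorem ext_fn {w v : H1} (h : w.fn =ᵐ[volume] v.fn) : w = v := by
  have h1 : fnL w = fnL v := Lp.ext h
  have hrep : w.rep = v.rep :=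
    rep_eq_of_ae_eq v.continuous_rep (h.trans v.rep_ae_eq.symm)
  have h2 : derivL w = derivL v := by
    refine Lp.ext ?_
    filter_upwards [w.isPrimitive_rep.ae_hasDerivAt, v.isPrimitive_rep.ae_hasDerivAt]
      with x hx hx'
    rw [hrep] at hx
    exact hx.unique hx'
  have h3 := norm_sq_eq (w - v)
  rw [map_sub, map_sub, h1, h2] at h3
  exact sub_eq_zero.1 (norm_eq_zero.1 (by simpa using h3))

/-- The element of `H¹` given by an absolutely continuous function with its derivative. -/
def ofPrimitive {f g : ℝ → ℝ} (h : IsPrimitive f g) (hf : MemLp f 2 volume)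
    (hg : MemLp g 2 volume) : H1 :=
  ⟨WithLp.toLp 2 (hf.toLp f, hg.toLp g), fun η hη hc => by
    have := h.isWeakDeriv η hη hc
    have e1 : ∫ z, (hf.toLp f) z * deriv η z = ∫ z, f z * deriv η z :=
      integral_congr_ae (by filter_upwards [hf.coeFn_toLp] with z hz; rw [hz])
    have e2 : ∫ z, (hg.toLp g) z * η z = ∫ z, g z * η z :=
      integral_congr_ae (by filter_upwards [hg.coeFn_toLp] with z hz; rw [hz])
    exact e1.trans (this.trans (congrArg Neg.neg e2.symm))⟩

section ofPrimitive

variable {f g : ℝ → ℝ} (h : IsPrimitive f g) (hf : MemLp f 2 volume) (hg : MemLp g 2 volume)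

theorem fn_ofPrimitive : (ofPrimitive h hf hg).fn =ᵐ[volume] f := hf.coeFn_toLp

theorem wderiv_ofPrimitive : (ofPrimitive h hf hg).wderiv =ᵐ[volume] g := hg.coeFn_toLp

end ofPrimitive

theorem rep_add (w v : H1) : (w + v).rep = w.rep + v.rep := by
  refine rep_eq_of_ae_eq (w.continuous_rep.add v.continuous_rep) ?_
  rw [fn_eq, map_add]
  filter_upwards [Lp.coeFn_add (fnL w) (fnL v), w.rep_ae_eq, v.rep_ae_eq] with x hx h1 h2
  rw [hx, Pi.add_apply, Pi.add_apply, h1, h2]; rfl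

theorem rep_sub (w v : H1) : (w - v).rep = w.rep - v.rep := by
  have := rep_add (w - v) v
  rw [sub_add_cancel] at this
  rw [this]; abel

/-- The square of the representative vanishes at infinity and has derivative 2ww', so w(x)² ≤ ∫
|2ww'| ≤ ‖w‖². -/
theorem abs_rep_le (w : H1) (x : ℝ) : |w.rep x| ≤ ‖w‖ := by
  have hp := w.isPrimitive_rep.mul w.isPrimitive_rep
  have i0 : Integrable fun x => w.wderiv x * w.rep x := w.memLp_wderiv.integrable_mul w.memLp_rep
  have i1 : Integrable fun x => w.wderiv x * w.rep x + w.rep x * w.wderiv x :=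
    i0.add (w.memLp_rep.integrable_mul w.memLp_wderiv)
  have h1 := hp.abs_le (p := 1) i1 one_ne_zero ENNReal.one_ne_top
    (memLp_one_iff_integrable.2 (w.memLp_rep.integrable_mul w.memLp_rep)) x
  have h2 : ∫ z, |w.wderiv z * w.rep z + w.rep z * w.wderiv z| ≤ ‖w‖ ^ 2 := by
    rw [norm_sq]
    refine integral_mono_ae i1.abs ?_ ?_
    · exact (Lp.memLp (fnL w)).integrable_sq.add (Lp.memLp (derivL w)).integrable_sq
    · filter_upwards [w.rep_ae_eq] with z hz
      rw [← hz]
      exact abs_le.2 ⟨by nlinarith [sq_nonneg (w.rep z + w.wderiv z)],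
        by nlinarith [sq_nonneg (w.rep z - w.wderiv z)]⟩
  refine abs_le_of_sq_le_sq ?_ (norm_nonneg w)
  have := (le_abs_self _).trans (h1.trans h2)
  nlinarith

/-- Chain rule in `H¹`. -/
theorem exists_comp (w : H1) {k k' : ℝ → ℝ} (hk : ∀ s, HasDerivAt k (k' s) s)
    (hk' : Continuous k') (hk0 : k 0 = 0) :
    ∃ v : H1, v.rep = (fun x => k (w.rep x)) ∧ v.wderiv =ᵐ[volume] fun x =>
      k' (w.rep x) * w.wderiv x := by
  -- The values of w lie in the compact interval [-‖w‖, ‖w‖], where k' is bounded and k is therefore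
  -- Lipschitz.
  obtain ⟨C, hC⟩ := (isCompact_Icc (a := -‖w‖) (b := ‖w‖)).exists_bound_of_continuousOn
    hk'.continuousOn
  have hmem : ∀ x, w.rep x ∈ Icc (-‖w‖) ‖w‖ := fun x => abs_le.1 (w.abs_rep_le x)
  have hcont : Continuous k := continuous_iff_continuousAt.2 fun s => (hk s).continuousAt
  have hp := w.isPrimitive_rep.comp hk hk'
  have h1 : MemLp (fun x => k (w.rep x)) 2 volume := by
    refine w.memLp_rep.of_le_mul (c := C)
      (hcont.comp w.continuous_rep).aestronglyMeasurable (Eventually.of_forall fun x => ?_)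
    have := (convex_Icc (-‖w‖) ‖w‖).norm_image_sub_le_of_norm_hasDerivWithin_le
      (fun s _ => (hk s).hasDerivWithinAt) (fun s hs => hC s hs)
      (show (0 : ℝ) ∈ Icc (-‖w‖) ‖w‖ by simp) (hmem x)
    simpa [hk0] using this
  have h2 : MemLp (fun x => k' (w.rep x) * w.wderiv x) 2 volume := by
    refine w.memLp_wderiv.of_le_mul (c := C)
      (((hk'.comp w.continuous_rep).aestronglyMeasurable).mul w.memLp_wderiv.1)
      (Eventually.of_forall fun x => ?_)
    rw [norm_mul]
    exact mul_le_mul_of_nonneg_right (hC _ (hmem x)) (norm_nonneg _)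
  exact ⟨ofPrimitive hp h1 h2, rep_eq_of_ae_eq hp.continuous (fn_ofPrimitive hp h1 h2),
    wderiv_ofPrimitive hp h1 h2⟩

end H1

/-! ### Multiplication operators on L² -/

theorem memLp_bcf_mul (b : ℝ →ᵇ ℝ) (f : L2) : MemLp (fun z => b z * f z) 2 volume :=
  (Lp.memLp f).of_le_mul (c := ‖b‖)
    (b.continuous.aestronglyMeasurable.mul (Lp.aestronglyMeasurable f))
    (Eventually.of_forall fun z => by
      rw [norm_mul]
      exact mul_le_mul_of_nonneg_right (b.norm_coe_le_norm z) (norm_nonneg _))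

theorem norm_toLp_bcf_mul_le (b : ℝ →ᵇ ℝ) (f : L2) :
    ‖(memLp_bcf_mul b f).toLp‖ ≤ ‖b‖ * ‖f‖ := by
  refine Lp.norm_le_mul_norm_of_ae_le_mul ?_
  filter_upwards [(memLp_bcf_mul b f).coeFn_toLp] with z hz
  rw [hz, norm_mul]
  exact mul_le_mul_of_nonneg_right (b.norm_coe_le_norm z) (norm_nonneg _)

/-- Multiplication of `L²` functions by a bounded continuous function. -/
def mulL (b : ℝ →ᵇ ℝ) : L2 →L[ℝ] L2 :=
  LinearMap.mkContinuous
    { toFun := fun f => (memLp_bcf_mul b f).toLp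
      map_add' := fun f g => by
        rw [← MemLp.toLp_add]
        refine (MemLp.toLp_eq_toLp_iff _ _).2 ?_
        filter_upwards [Lp.coeFn_add f g] with z hz
        simp only [hz, Pi.add_apply, mul_add]
      map_smul' := fun c f => by
        rw [RingHom.id_apply, ← MemLp.toLp_const_smul]
        refine (MemLp.toLp_eq_toLp_iff _ _).2 ?_
        filter_upwards [Lp.coeFn_smul c f] with z hz
        simp only [hz, Pi.smul_apply, smul_eq_mul]
        ring }
    ‖b‖ (norm_toLp_bcf_mul_le b)

theorem mulL_ae_eq (b : ℝ →ᵇ ℝ) (f : L2) : mulL b f =ᵐ[volume] fun z => b z * f z :=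
  (memLp_bcf_mul b f).coeFn_toLp

theorem norm_mulL_le (b : ℝ →ᵇ ℝ) (f : L2) : ‖mulL b f‖ ≤ ‖b‖ * ‖f‖ :=
  norm_toLp_bcf_mul_le b f

theorem mulL_sub (b c : ℝ →ᵇ ℝ) (f : L2) : mulL (b - c) f = mulL b f - mulL c f := by
  refine Lp.ext ?_
  filter_upwards [mulL_ae_eq (b - c) f, mulL_ae_eq b f, mulL_ae_eq c f,
    Lp.coeFn_sub (mulL b f) (mulL c f)] with z h1 h2 h3 h4
  rw [h1, h4, Pi.sub_apply, h2, h3, BoundedContinuousFunction.coe_sub, Pi.sub_apply]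
  ring

theorem inner_mulL (b : ℝ →ᵇ ℝ) (f g : L2) :
    inner ℝ (mulL b f) g = ∫ z, b z * f z * g z := by
  rw [L2.inner_eq_integral]
  refine integral_congr_ae ?_
  filter_upwards [mulL_ae_eq b f] with z hz
  rw [hz]

/-! ### The uniformly elliptic problem and its velocity -/

/-- `a` is a Lipschitz coefficient with values in `[α, β]`, `α > 0`, normalised by `a 0 = 1`. -/
structure IsCoeff (a : ℝ → ℝ) (α β Λ : ℝ) : Prop where
  pos : 0 < α
  lower : ∀ s, α ≤ a s
  upper : ∀ s, a s ≤ β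
  lip : ∀ s t, |a s - a t| ≤ Λ * |s - t|
  map_zero : a 0 = 1

namespace IsCoeff

variable {a : ℝ → ℝ} {α β Λ : ℝ} (ha : IsCoeff a α β Λ)

include ha

theorem alpha_le_one : α ≤ 1 := ha.map_zero ▸ ha.lower 0

theorem one_le_beta : 1 ≤ β := ha.map_zero ▸ ha.upper 0

theorem pos' (s : ℝ) : 0 < a s := ha.pos.trans_le (ha.lower s)

theorem lip_nonneg : 0 ≤ Λ := by
  have := (abs_nonneg _).trans (ha.lip 1 0)
  simpa using this

theorem continuous : Continuous a := by
  have : LipschitzWith ⟨Λ, ha.lip_nonneg⟩ a := LipschitzWith.of_dist_le_mul fun s t => by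
    rw [Real.dist_eq, Real.dist_eq]; exact ha.lip s t
  exact this.continuous

/-- The coefficient evaluated along an `H¹` function. -/
def bcf (w : H1) : ℝ →ᵇ ℝ :=
  BoundedContinuousFunction.ofNormedAddCommGroup (fun x => a (w.rep x))
    (ha.continuous.comp w.continuous_rep) β fun x => by
      rw [Real.norm_of_nonneg (ha.pos' _).le]; exact ha.upper _

theorem norm_bcf_sub_le (w v : H1) : ‖ha.bcf w - ha.bcf v‖ ≤ Λ * ‖w - v‖ := by
  have := ha.lip_nonneg
  refine (BoundedContinuousFunction.norm_le (by positivity)).2 fun x => ?_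
  refine (ha.lip (w.rep x) (v.rep x)).trans ?_
  gcongr
  have := (w - v).abs_rep_le x
  rwa [H1.rep_sub] at this

theorem memLp_source (w : H1) : MemLp (fun x => a (w.rep x) - 1) 2 volume :=
  w.memLp_rep.of_le_mul (c := Λ)
    ((ha.continuous.comp w.continuous_rep).sub continuous_const).aestronglyMeasurable
    (Eventually.of_forall fun x => by
      have := ha.lip (w.rep x) 0
      rwa [ha.map_zero, sub_zero] at this)

/-- The source term `a(w) - 1` in `L²`. -/
def source (w : H1) : L2 := (ha.memLp_source w).toLp

theorem source_ae_eq (w : H1) : ha.source w =ᵐ[volume] fun x => a (w.rep x) - 1 :=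
  (ha.memLp_source w).coeFn_toLp

theorem norm_source_sub_le (w v : H1) : ‖ha.source w - ha.source v‖ ≤ Λ * ‖w - v‖ := by
  have hΛ := ha.lip_nonneg
  refine le_trans (b := Λ * ‖H1.fnL (w - v)‖) ?_ (by gcongr; exact H1.norm_fnL_le _)
  refine Lp.norm_le_mul_norm_of_ae_le_mul ?_
  filter_upwards [Lp.coeFn_sub (ha.source w) (ha.source v), ha.source_ae_eq w, ha.source_ae_eq v,
    (w - v).rep_ae_eq] with x h1 h2 h3 h4
  rw [← H1.fn_eq, ← h4, H1.rep_sub, h1, Pi.sub_apply, h2, h3]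
  simpa using ha.lip (w.rep x) (v.rep x)

theorem source_zero : ha.source 0 = 0 := by
  have h0 : (0 : H1).rep = fun _ => 0 :=
    H1.rep_eq_of_ae_eq continuous_const (Lp.coeFn_zero ℝ 2 volume)
  refine Lp.ext ?_
  filter_upwards [ha.source_ae_eq 0, Lp.coeFn_zero ℝ 2 (volume : Measure ℝ)] with x h1 h2
  rw [h1, h2, h0, ha.map_zero]; simp

/-- `u` solves `-(a(w) u_z)_z + u = -(a(w))_z` weakly. -/
def IsWeakSolution (w u : H1) : Prop :=
  ∀ V : H1, inner ℝ (mulL (ha.bcf w) (H1.derivL u)) (H1.derivL V) + inner ℝ (H1.fnL u) (H1.fnL V)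
    = inner ℝ (ha.source w) (H1.derivL V)

/-- The normalisation a(0) = 1 forces α ≤ 1, so α also serves as a lower bound for the zeroth-order
term. -/
theorem coercive (w u : H1) : α * ‖u‖ ^ 2 ≤
    inner ℝ (mulL (ha.bcf w) (H1.derivL u)) (H1.derivL u) + inner ℝ (H1.fnL u) (H1.fnL u) := by
  have h1 : α * ‖H1.derivL u‖ ^ 2 ≤ inner ℝ (mulL (ha.bcf w) (H1.derivL u)) (H1.derivL u) := by
    have i0 : Integrable fun z => (H1.derivL u) z * (H1.derivL u) z := L2.integrable_mul _ _
    rw [inner_mulL, L2.norm_sq_eq_integral, ← integral_const_mul]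
    refine integral_mono ?_ ?_ fun z => ?_
    · simpa only [pow_two] using i0.const_mul α
    · have := i0.bdd_mul (c := ‖ha.bcf w‖) (ha.bcf w).continuous.aestronglyMeasurable
        (Eventually.of_forall fun z => (ha.bcf w).norm_coe_le_norm z)
      simpa only [mul_assoc] using this
    · have : α ≤ ha.bcf w z := ha.lower _
      change α * (H1.derivL u) z ^ 2 ≤ ha.bcf w z * (H1.derivL u) z * (H1.derivL u) z
      nlinarith [mul_le_mul_of_nonneg_right this (sq_nonneg ((H1.derivL u) z))]
  rw [real_inner_self_eq_norm_sq, H1.norm_sq_eq]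
  nlinarith [ha.alpha_le_one, sq_nonneg ‖H1.fnL u‖]

/-- Lax-Milgram, with the source functional represented through the adjoint of the derivative
operator. -/
theorem exists_isWeakSolution (w : H1) : ∃ u, ha.IsWeakSolution w u := by
  let A : H1 →L[ℝ] H1 :=
    (ContinuousLinearMap.adjoint H1.derivL).comp ((mulL (ha.bcf w)).comp H1.derivL)
      + (ContinuousLinearMap.adjoint H1.fnL).comp H1.fnL
  let B : H1 →L[ℝ] H1 →L[ℝ] ℝ := (innerSL ℝ).comp A
  have hB : ∀ u V, B u V = inner ℝ (mulL (ha.bcf w) (H1.derivL u)) (H1.derivL V)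
      + inner ℝ (H1.fnL u) (H1.fnL V) := fun u V => by
    simp [B, A, ContinuousLinearMap.adjoint_inner_left]
  have hco : IsCoercive B := ⟨α, ha.pos, fun u => by
    rw [hB, mul_assoc, ← pow_two]; exact ha.coercive w u⟩
  refine ⟨hco.continuousLinearEquivOfBilin.symm
    (ContinuousLinearMap.adjoint H1.derivL (ha.source w)), fun V => ?_⟩
  rw [← hB, ← hco.continuousLinearEquivOfBilin_apply, ContinuousLinearEquiv.apply_symm_apply,
    ContinuousLinearMap.adjoint_inner_left]

/-- Subtract the two equations and test with u - v; the change of coefficient acts on v_z and is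
bounded in sup norm by Λ‖w - y‖. The case w = y gives uniqueness, y = v = 0 a linear bound, and the
general case the local Lipschitz estimate. -/
theorem norm_sub_le_of_isWeakSolution {w y u v : H1} (hu : ha.IsWeakSolution w u)
    (hv : ha.IsWeakSolution y v) : α * ‖u - v‖ ≤ Λ * ‖w - y‖ * (1 + ‖v‖) := by
  have hΛ := ha.lip_nonneg
  have h1 := hu (u - v)
  have h2 := hv (u - v)
  have h3 := ha.coercive w (u - v)
  have key : inner ℝ (mulL (ha.bcf w) (H1.derivL (u - v))) (H1.derivL (u - v))
      + inner ℝ (H1.fnL (u - v)) (H1.fnL (u - v)) =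
      inner ℝ (ha.source w - ha.source y - mulL (ha.bcf w - ha.bcf y) (H1.derivL v))
        (H1.derivL (u - v)) := by
    rw [inner_sub_left, inner_sub_left, ← h1, ← h2, mulL_sub, inner_sub_left,
      map_sub H1.derivL, map_sub H1.fnL, map_sub (mulL (ha.bcf w)), inner_sub_left (mulL _ _),
      inner_sub_left (H1.fnL u)]
    ring
  rw [key] at h3
  have h4 := h3.trans (real_inner_le_norm _ _)
  have h5 : ‖ha.source w - ha.source y - mulL (ha.bcf w - ha.bcf y) (H1.derivL v)‖
      ≤ Λ * ‖w - y‖ * (1 + ‖v‖) := by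
    refine (norm_sub_le _ _).trans ?_
    have e1 := ha.norm_source_sub_le w y
    have e2 : ‖mulL (ha.bcf w - ha.bcf y) (H1.derivL v)‖ ≤ Λ * ‖w - y‖ * ‖v‖ :=
      (norm_mulL_le _ _).trans (mul_le_mul (ha.norm_bcf_sub_le w y) (H1.norm_derivL_le v)
        (norm_nonneg _) (by positivity))
    linarith
  rcases (norm_nonneg (u - v)).eq_or_lt with h0 | h0
  · rw [← h0, mul_zero]; positivity
  · refine le_of_mul_le_mul_right ?_ h0
    calc α * ‖u - v‖ * ‖u - v‖ = α * ‖u - v‖ ^ 2 := by ring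
      _ ≤ _ := h4
      _ ≤ _ := mul_le_mul h5 (H1.norm_derivL_le _) (norm_nonneg _) (by positivity)

/-- The velocity `u = L⁻¹[-(a(w))_z]`. -/
def velocity (w : H1) : H1 := (ha.exists_isWeakSolution w).choose

theorem isWeakSolution_velocity (w : H1) : ha.IsWeakSolution w (ha.velocity w) :=
  (ha.exists_isWeakSolution w).choose_spec

theorem IsWeakSolution.eq_velocity {w u : H1} (h : ha.IsWeakSolution w u) :
    u = ha.velocity w := by
  have := ha.norm_sub_le_of_isWeakSolution h (ha.isWeakSolution_velocity w)
  rw [sub_self, norm_zero, mul_zero, zero_mul] at this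
  have h2 : ‖u - ha.velocity w‖ ≤ 0 := by
    by_contra h0
    push Not at h0
    nlinarith [mul_pos ha.pos h0]
  exact sub_eq_zero.1 (norm_le_zero_iff.1 h2)

theorem norm_velocity_le (w : H1) : ‖ha.velocity w‖ ≤ Λ / α * ‖w‖ := by
  have h0 : ha.IsWeakSolution 0 0 := fun V => by simp [ha.source_zero]
  have := ha.norm_sub_le_of_isWeakSolution (ha.isWeakSolution_velocity w) h0
  simp only [sub_zero, norm_zero, add_zero, mul_one] at this
  rw [div_mul_eq_mul_div, le_div_iff₀ ha.pos]
  linarith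

theorem norm_velocity_sub_le (w y : H1) :
    ‖ha.velocity w - ha.velocity y‖ ≤ Λ / α * (1 + Λ / α * ‖y‖) * ‖w - y‖ := by
  have h1 := ha.norm_sub_le_of_isWeakSolution (ha.isWeakSolution_velocity w)
    (ha.isWeakSolution_velocity y)
  have h2 := ha.norm_velocity_le y
  have hΛ := ha.lip_nonneg
  rw [div_mul_eq_mul_div, div_mul_eq_mul_div, le_div_iff₀ ha.pos, mul_comm _ α]
  refine h1.trans ?_
  calc Λ * ‖w - y‖ * (1 + ‖ha.velocity y‖) ≤ Λ * ‖w - y‖ * (1 + Λ / α * ‖y‖) := by gcongr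
    _ = _ := by ring

end IsCoeff

/-- The bridge between the degenerate problem and the truncated one: for m = 0 the integrands agree
almost everywhere wherever the truncation is inactive. -/
theorem isEllipticSolution_iff {a : ℝ → ℝ} {α β Λ n : ℝ} (ha : IsCoeff a α β Λ) {w u : H1}
    (h : ∀ z, (1 + w.rep z) ^ n = a (w.rep z)) :
    IsEllipticSolution n 0 w u ↔ ha.IsWeakSolution w u := by
  refine forall_congr' fun V => ?_
  have h1 : ∫ z, (porosity w z ^ n * u.wderiv z * V.wderiv z
      + porosity w z ^ (0 : ℝ) * u.fn z * V.fn z) =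
      inner ℝ (mulL (ha.bcf w) (H1.derivL u)) (H1.derivL V)
        + inner ℝ (H1.fnL u) (H1.fnL V) := by
    rw [inner_mulL, L2.inner_eq_integral, ← integral_add]
    · refine integral_congr_ae ?_
      filter_upwards [w.rep_ae_eq] with z hz
      have : porosity w z ^ n = ha.bcf w z := by
        rw [porosity, ← hz, h z]; rfl
      rw [this, Real.rpow_zero, one_mul]; rfl
    · have := (L2.integrable_mul (H1.derivL u) (H1.derivL V)).bdd_mul (c := ‖ha.bcf w‖)
        (ha.bcf w).continuous.aestronglyMeasurable
        (Eventually.of_forall fun z => (ha.bcf w).norm_coe_le_norm z)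
      simpa only [mul_assoc] using this
    · exact L2.integrable_mul _ _
  have h2 : ∫ z, (porosity w z ^ n - 1) * V.wderiv z = inner ℝ (ha.source w) (H1.derivL V) := by
    rw [L2.inner_eq_integral]
    refine integral_congr_ae ?_
    filter_upwards [w.rep_ae_eq, ha.source_ae_eq w] with z hz hs
    rw [hs, porosity, ← hz, h z]; rfl
  rw [h1, h2]

/-! ### Global flow of the cut-off velocity field -/

/-- A bounded Lipschitz vector field on a Banach space has global integral curves. -/
theorem exists_integralCurve_of_lipschitz_bounded {E : Type*} [NormedAddCommGroup E]
    [NormedSpace ℝ E] [CompleteSpace E] {F : E → E} {K L : ℝ≥0} (hF : LipschitzWith K F)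
    (hL : ∀ x, ‖F x‖ ≤ L) (x₀ : E) :
    ∃ w : ℝ → E, w 0 = x₀ ∧ ∀ t, HasDerivAt w (F (w t)) t := by
  have hloc : ∀ N : ℕ, ∃ γ : ℝ → E, γ 0 = x₀ ∧
      ∀ t ∈ Ioo (-((N : ℝ) + 1)) (N + 1), HasDerivAt γ (F (γ t)) t := by
    intro N
    have h0 : (0 : ℝ) ∈ Icc (-((N : ℝ) + 1)) (N + 1) := ⟨by linarith [N.cast_nonneg (α := ℝ)],
      by positivity⟩
    -- The field is bounded by L everywhere, so a ball of radius L(N + 1) contains the curve on the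
    -- whole window and its length need not shrink.
    have hPL : IsPicardLindelof (fun _ => F) (⟨0, h0⟩ : Icc (-((N : ℝ) + 1)) (N + 1)) x₀
        (L * (N + 1)) 0 L K :=
      IsPicardLindelof.of_time_independent (fun x _ => hL x) (hF.lipschitzOnWith)
        (by simp)
    obtain ⟨γ, hγ0, hγ⟩ := hPL.exists_eq_forall_mem_Icc_hasDerivWithinAt₀
    exact ⟨γ, hγ0, fun t ht => (hγ t (Ioo_subset_Icc_self ht)).hasDerivAt (Icc_mem_nhds ht.1 ht.2)⟩
  choose γ hγ0 hγ using hloc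
  have huniq : ∀ M N : ℕ, M ≤ N → EqOn (γ M) (γ N) (Ioo (-((M : ℝ) + 1)) (M + 1)) := by
    intro M N hMN
    have hMN' : (M : ℝ) ≤ N := by exact_mod_cast hMN
    refine ODE_solution_unique_of_mem_Ioo (v := fun _ => F) (s := fun _ => univ) (K := K)
      (t₀ := 0) (fun t _ => hF.lipschitzOnWith) ⟨by linarith [M.cast_nonneg (α := ℝ)],
        by positivity⟩ (fun t ht => ⟨hγ M t ht, mem_univ _⟩) (fun t ht => ⟨hγ N t ?_, mem_univ _⟩)
      ((hγ0 M).trans (hγ0 N).symm)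
    exact ⟨by linarith [ht.1], by linarith [ht.2]⟩
  have hmem : ∀ t : ℝ, t ∈ Ioo (-((⌈|t|⌉₊ : ℝ) + 1)) (⌈|t|⌉₊ + 1) := fun t => by
    have := Nat.le_ceil |t|
    exact ⟨by linarith [neg_abs_le t], by linarith [le_abs_self t]⟩
  refine ⟨fun t => γ ⌈|t|⌉₊ t, by simpa using hγ0 _, fun t => ?_⟩
  -- The ceiling jumps at integers; the curve with the next index agrees with the patched one on
  -- both sides of t.
  have hev : (fun s => γ ⌈|s|⌉₊ s) =ᶠ[𝓝 t] γ (⌈|t|⌉₊ + 1) := by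
    have h1 : ∀ᶠ s in 𝓝 t, |s| < (⌈|t|⌉₊ : ℝ) + 1 :=
      continuous_abs.continuousAt.eventually (gt_mem_nhds (by linarith [Nat.le_ceil |t|]))
    filter_upwards [h1] with s hs
    refine huniq _ _ ?_ (hmem s)
    exact Nat.ceil_le.2 (by exact_mod_cast hs.le)
  have h2 : γ (⌈|t|⌉₊ + 1) t = γ ⌈|t|⌉₊ t := (huniq _ _ (Nat.le_succ _) (hmem t)).symm
  have h3 := hγ (⌈|t|⌉₊ + 1) t ⟨by push_cast; linarith [(hmem t).1], by
    push_cast; linarith [(hmem t).2]⟩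
  rw [h2] at h3
  exact h3.congr_of_eventuallyEq hev

/-- A Lipschitz cutoff equal to `1` on `(-∞, R]` and to `0` on `[R + 1, ∞)`. -/
def cutoff (R r : ℝ) : ℝ := max 0 (min 1 (R + 1 - r))

theorem cutoff_nonneg (R r : ℝ) : 0 ≤ cutoff R r := le_max_left _ _

theorem cutoff_le_one (R r : ℝ) : cutoff R r ≤ 1 := max_le zero_le_one (min_le_left _ _)

theorem cutoff_eq_one {R r : ℝ} (h : r ≤ R) : cutoff R r = 1 := by
  rw [cutoff, min_eq_left (by linarith), max_eq_right zero_le_one]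

theorem cutoff_eq_zero {R r : ℝ} (h : R + 1 ≤ r) : cutoff R r = 0 := by
  rw [cutoff, max_eq_left ((min_le_right _ _).trans (by linarith))]

theorem abs_cutoff_sub_le (R r s : ℝ) : |cutoff R r - cutoff R s| ≤ |r - s| := by
  refine (abs_max_sub_max_le_max _ _ _ _).trans (max_le (by simp) ?_)
  refine (abs_min_sub_min_le_max _ _ _ _).trans (max_le (by simp) ?_)
  rw [abs_sub_comm r s]
  exact le_of_eq (by ring_nf)

namespace IsCoeff

variable {a : ℝ → ℝ} {α β Λ : ℝ} (ha : IsCoeff a α β Λ)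

/-- The velocity field cut off outside a ball of `H¹`. -/
def field (R : ℝ) (w : H1) : H1 := cutoff R ‖w‖ • ha.velocity w

include ha

theorem field_eq {R : ℝ} {w : H1} (h : ‖w‖ ≤ R) : ha.field R w = ha.velocity w := by
  rw [field, cutoff_eq_one h, one_smul]

theorem field_eq_zero {R : ℝ} {w : H1} (h : R + 1 ≤ ‖w‖) : ha.field R w = 0 := by
  rw [field, cutoff_eq_zero h, zero_smul]

theorem norm_field_le {R : ℝ} (hR : 0 ≤ R) (w : H1) : ‖ha.field R w‖ ≤ Λ / α * (R + 1) := by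
  have hq : 0 ≤ Λ / α := div_nonneg ha.lip_nonneg ha.pos.le
  rcases le_total ‖w‖ (R + 1) with h | h
  · rw [field, norm_smul, Real.norm_of_nonneg (cutoff_nonneg _ _)]
    calc _ ≤ 1 * (Λ / α * ‖w‖) := mul_le_mul (cutoff_le_one _ _) (ha.norm_velocity_le w)
          (norm_nonneg _) zero_le_one
      _ ≤ _ := by rw [one_mul]; gcongr
  · rw [ha.field_eq_zero h, norm_zero]; positivity

/-- The Lipschitz constant of the velocity grows only with the norm of one argument. By symmetry
that argument may be taken in the ball of radius R + 1, since the field vanishes at both points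
otherwise. -/
theorem norm_field_sub_le {R : ℝ} (hR : 0 ≤ R) (w y : H1) :
    ‖ha.field R w - ha.field R y‖ ≤
      (Λ / α * (1 + Λ / α * (R + 1)) + Λ / α * (R + 1)) * ‖w - y‖ := by
  have hq : 0 ≤ Λ / α := div_nonneg ha.lip_nonneg ha.pos.le
  have main : ∀ w y : H1, ‖y‖ ≤ R + 1 → ‖ha.field R w - ha.field R y‖ ≤
      (Λ / α * (1 + Λ / α * (R + 1)) + Λ / α * (R + 1)) * ‖w - y‖ := by
    intro w y hy
    have e : ha.field R w - ha.field R y = cutoff R ‖w‖ • (ha.velocity w - ha.velocity y)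
        + (cutoff R ‖w‖ - cutoff R ‖y‖) • ha.velocity y := by
      simp only [field, smul_sub, sub_smul]; abel
    rw [e, add_mul]
    refine (norm_add_le _ _).trans (add_le_add ?_ ?_)
    · rw [norm_smul, Real.norm_of_nonneg (cutoff_nonneg _ _)]
      calc _ ≤ 1 * (Λ / α * (1 + Λ / α * ‖y‖) * ‖w - y‖) :=
            mul_le_mul (cutoff_le_one _ _) (ha.norm_velocity_sub_le w y) (norm_nonneg _) zero_le_one
        _ ≤ _ := by rw [one_mul]; gcongr
    · rw [norm_smul, mul_comm]
      refine mul_le_mul ((ha.norm_velocity_le y).trans (by gcongr)) ?_ (norm_nonneg _)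
        (by positivity)
      exact (abs_cutoff_sub_le _ _ _).trans (abs_norm_sub_norm_le _ _)
  rcases le_total ‖y‖ (R + 1) with h | h
  · exact main w y h
  · rcases le_total ‖w‖ (R + 1) with h' | h'
    · rw [norm_sub_rev, norm_sub_rev w y]; exact main y w h'
    · rw [ha.field_eq_zero h, ha.field_eq_zero h', sub_zero, norm_zero]; positivity

theorem exists_lipschitzWith_field {R : ℝ} (hR : 0 ≤ R) :
    ∃ K : ℝ≥0, LipschitzWith K (ha.field R) := by
  have hq : 0 ≤ Λ / α := div_nonneg ha.lip_nonneg ha.pos.le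
  refine ⟨⟨Λ / α * (1 + Λ / α * (R + 1)) + Λ / α * (R + 1), by positivity⟩,
    LipschitzWith.of_dist_le_mul fun w y => ?_⟩
  rw [dist_eq_norm, dist_eq_norm]
  exact ha.norm_field_sub_le hR w y

theorem exists_flow {R : ℝ} (hR : 0 ≤ R) (w₀ : H1) :
    ∃ w : ℝ → H1, w 0 = w₀ ∧ ∀ t, HasDerivAt w (ha.field R (w t)) t := by
  have hq : 0 ≤ Λ / α := div_nonneg ha.lip_nonneg ha.pos.le
  obtain ⟨K, hK⟩ := ha.exists_lipschitzWith_field hR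
  exact exists_integralCurve_of_lipschitz_bounded hK
    (L := ⟨Λ / α * (R + 1), by positivity⟩) (ha.norm_field_le hR) w₀

end IsCoeff

/-! ### Conserved energy and the Modica-Mortola bound -/

/-- Second-order Taylor formula with Lagrange remainder, on either side of the base point. -/
theorem exists_taylor_two {p p₁ p₂ : ℝ → ℝ} (h₁ : ∀ x, HasDerivAt p (p₁ x) x)
    (h₂ : ∀ x, HasDerivAt p₁ (p₂ x) x) (s t : ℝ) :
    ∃ d ∈ uIcc s t, p t = p s + p₁ s * (t - s) + p₂ d * (t - s) ^ 2 / 2 := by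
  have main : ∀ {p p₁ p₂ : ℝ → ℝ}, (∀ x, HasDerivAt p (p₁ x) x) → (∀ x, HasDerivAt p₁ (p₂ x) x) →
      ∀ s t, s < t → ∃ d ∈ Icc s t, p t = p s + p₁ s * (t - s) + p₂ d * (t - s) ^ 2 / 2 := by
    intro p p₁ p₂ h₁ h₂ s t hst
    -- Cauchy's mean value theorem compares the first-order remainder with (x - s)²; the ordinary
    -- one is then applied to p₁.
    obtain ⟨e, he, hce⟩ := exists_ratio_hasDerivAt_eq_ratio_slope
      (fun x => p x - p s - p₁ s * (x - s)) (fun x => p₁ x - p₁ s) hst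
      (by have := fun x => (h₁ x).continuousAt
          have : Continuous p := continuous_iff_continuousAt.2 this
          fun_prop)
      (fun x _ => by
        convert! ((h₁ x).sub_const (p s)).sub
          (((hasDerivAt_id x).sub_const s).const_mul (p₁ s)) using 1
        rw [mul_one])
      (fun x => (x - s) ^ 2) (fun x => 2 * (x - s)) (by fun_prop)
      (fun x _ => by
        convert! ((hasDerivAt_id x).sub_const s).pow 2 using 1
        simp)
    obtain ⟨d, hd, hcd⟩ := exists_hasDerivAt_eq_slope p₁ p₂ he.1
      ((continuous_iff_continuousAt.2 fun x => (h₂ x).continuousAt).continuousOn)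
      (fun x _ => h₂ x)
    refine ⟨d, ⟨hd.1.le, hd.2.le.trans he.2.le⟩, ?_⟩
    have hes : e - s ≠ 0 := (sub_pos.2 he.1).ne'
    rw [eq_div_iff hes] at hcd
    simp only [sub_self, mul_zero, sub_zero] at hce
    rw [← hcd] at hce
    have := mul_right_cancel₀ hes (a := p₂ d * (t - s) ^ 2)
      (c := 2 * (p t - p s - p₁ s * (t - s))) (by linear_combination hce)
    linarith
  rcases lt_trichotomy s t with hst | rfl | hst
  · rw [uIcc_of_le hst.le]; exact main h₁ h₂ s t hst
  · exact ⟨s, by simp, by ring⟩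
  · obtain ⟨d, hd, h⟩ := main (p := fun x => p (-x)) (p₁ := fun x => -p₁ (-x))
      (p₂ := fun x => p₂ (-x)) (fun x => by
        convert! (h₁ (-x)).comp x (hasDerivAt_neg x) using 1
        ring)
      (fun x => by
        convert! ((h₂ (-x)).comp x (hasDerivAt_neg x)).neg using 1
        ring) (-s) (-t) (by linarith)
    refine ⟨-d, ?_, ?_⟩
    · rw [uIcc_of_ge hst.le]; exact ⟨by linarith [hd.2], by linarith [hd.1]⟩
    · simp only [neg_neg] at h; rw [h]; ring

theorem hasDerivAt_integral_of_continuous {E : Type*} [NormedAddCommGroup E] [NormedSpace ℝ E]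
    [CompleteSpace E] {k : ℝ → E} (hk : Continuous k) (b s : ℝ) :
    HasDerivAt (fun x => ∫ r in b..x, k r) (k s) s :=
  intervalIntegral.integral_hasDerivAt_right (hk.intervalIntegrable _ _)
    (hk.stronglyMeasurableAtFilter _ _) hk.continuousAt

theorem H1.inner_fnL (w v : H1) :
    inner ℝ (H1.fnL w) (H1.fnL v) = ∫ z, w.rep z * v.rep z := by
  rw [L2.inner_eq_integral]
  refine integral_congr_ae ?_
  filter_upwards [w.rep_ae_eq, v.rep_ae_eq] with z h1 h2
  rw [h1, h2]; rfl

namespace IsCoeff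

/-- The derivative of the potential: the primitive of `1 / a` vanishing at `0`. -/
def potDeriv (a : ℝ → ℝ) (s : ℝ) : ℝ := ∫ r in (0 : ℝ)..s, (a r)⁻¹

/-- The potential `Φ` with `Φ'' = 1 / a`, `Φ 0 = Φ' 0 = 0`. -/
def pot (a : ℝ → ℝ) (s : ℝ) : ℝ := ∫ r in (0 : ℝ)..s, potDeriv a r

/-- The conserved energy `½ ‖w_z‖² + ∫ Φ(w)`. -/
def energy (a : ℝ → ℝ) (w : H1) : ℝ := ‖H1.derivL w‖ ^ 2 / 2 + ∫ z, pot a (w.rep z)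

/-- The Modica-Mortola function, with derivative `√(2Φ)`. -/
def barrier (a : ℝ → ℝ) (s : ℝ) : ℝ := ∫ r in (0 : ℝ)..s, √(2 * pot a r)

theorem potDeriv_zero (a : ℝ → ℝ) : potDeriv a 0 = 0 := intervalIntegral.integral_same

theorem pot_zero (a : ℝ → ℝ) : pot a 0 = 0 := intervalIntegral.integral_same

variable {a : ℝ → ℝ} {α β Λ : ℝ} (ha : IsCoeff a α β Λ)

include ha

theorem continuous_inv : Continuous fun s => (a s)⁻¹ :=
  ha.continuous.inv₀ fun s => (ha.pos' s).ne'

theorem hasDerivAt_potDeriv (s : ℝ) : HasDerivAt (potDeriv a) (a s)⁻¹ s :=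
  hasDerivAt_integral_of_continuous ha.continuous_inv 0 s

theorem continuous_potDeriv : Continuous (potDeriv a) :=
  continuous_iff_continuousAt.2 fun s => (ha.hasDerivAt_potDeriv s).continuousAt

theorem hasDerivAt_pot (s : ℝ) : HasDerivAt (pot a) (potDeriv a s) s :=
  hasDerivAt_integral_of_continuous ha.continuous_potDeriv 0 s

theorem continuous_pot : Continuous (pot a) :=
  continuous_iff_continuousAt.2 fun s => (ha.hasDerivAt_pot s).continuousAt

theorem exists_pot_eq (s t : ℝ) : ∃ d ∈ uIcc s t,
    pot a t = pot a s + potDeriv a s * (t - s) + (a d)⁻¹ * (t - s) ^ 2 / 2 :=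
  exists_taylor_two ha.hasDerivAt_pot ha.hasDerivAt_potDeriv s t

theorem potDeriv_nonneg {s : ℝ} (hs : 0 ≤ s) : 0 ≤ potDeriv a s :=
  intervalIntegral.integral_nonneg hs fun r _ => (inv_pos.2 (ha.pos' r)).le

theorem potDeriv_nonpos {s : ℝ} (hs : s ≤ 0) : potDeriv a s ≤ 0 := by
  rw [potDeriv, intervalIntegral.integral_symm, neg_nonpos]
  exact intervalIntegral.integral_nonneg hs fun r _ => (inv_pos.2 (ha.pos' r)).le

theorem pot_le (s : ℝ) : pot a s ≤ α⁻¹ * s ^ 2 / 2 := by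
  obtain ⟨d, -, h⟩ := ha.exists_pot_eq 0 s
  rw [h, pot_zero, potDeriv_zero]
  have := inv_anti₀ ha.pos (ha.lower d)
  nlinarith [mul_le_mul_of_nonneg_right this (sq_nonneg s)]

theorem le_pot (s : ℝ) : β⁻¹ * s ^ 2 / 2 ≤ pot a s := by
  obtain ⟨d, -, h⟩ := ha.exists_pot_eq 0 s
  rw [h, pot_zero, potDeriv_zero]
  have := inv_anti₀ (ha.pos' d) (ha.upper d)
  nlinarith [mul_le_mul_of_nonneg_right this (sq_nonneg s)]

theorem pot_nonneg (s : ℝ) : 0 ≤ pot a s := by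
  refine le_trans ?_ (ha.le_pot s)
  have := zero_le_one.trans ha.one_le_beta
  positivity

theorem abs_pot_sub_le (s t : ℝ) :
    |pot a t - pot a s - potDeriv a s * (t - s)| ≤ α⁻¹ / 2 * (t - s) ^ 2 := by
  obtain ⟨d, -, h⟩ := ha.exists_pot_eq s t
  have e : pot a t - pot a s - potDeriv a s * (t - s) = (a d)⁻¹ * (t - s) ^ 2 / 2 := by
    rw [h]; ring
  have h0 := inv_pos.2 (ha.pos' d)
  rw [e, abs_of_nonneg (by positivity)]
  have := inv_anti₀ ha.pos (ha.lower d)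
  nlinarith [mul_le_mul_of_nonneg_right this (sq_nonneg (t - s))]

theorem integrable_pot (w : H1) : Integrable fun z => pot a (w.rep z) := by
  refine (w.memLp_rep.integrable_sq.const_mul (α⁻¹ / 2)).mono'
    (ha.continuous_pot.comp w.continuous_rep).aestronglyMeasurable (Eventually.of_forall fun z => ?_)
  rw [Real.norm_of_nonneg (ha.pot_nonneg _)]
  linarith [ha.pot_le (w.rep z)]

theorem exists_potDeriv_comp (w : H1) : ∃ V : H1, V.rep = (fun z => potDeriv a (w.rep z)) ∧
    V.wderiv =ᵐ[volume] fun z => (a (w.rep z))⁻¹ * w.wderiv z :=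
  w.exists_comp ha.hasDerivAt_potDeriv ha.continuous_inv (potDeriv_zero a)

/-- The pointwise Taylor remainder is at most a multiple of h², so after integration it is O(‖h‖²).
-/
theorem hasFDerivAt_integral_pot {w V : H1} (hV : V.rep = fun z => potDeriv a (w.rep z)) :
    HasFDerivAt (fun v : H1 => ∫ z, pot a (v.rep z))
      ((innerSL ℝ (H1.fnL V)).comp H1.fnL) w := by
  rw [hasFDerivAt_iff_isLittleO_nhds_zero]
  have hO : (fun h : H1 => (∫ z, pot a ((w + h).rep z)) - (∫ z, pot a (w.rep z))
      - ((innerSL ℝ (H1.fnL V)).comp H1.fnL) h) =O[𝓝 0] fun h => ‖h‖ ^ 2 := by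
    refine Asymptotics.IsBigO.of_bound (α⁻¹ / 2) (Eventually.of_forall fun h => ?_)
    have i3 : Integrable fun z => V.rep z * h.rep z := V.memLp_rep.integrable_mul h.memLp_rep
    have e : ((innerSL ℝ (H1.fnL V)).comp H1.fnL) h = ∫ z, V.rep z * h.rep z := H1.inner_fnL V h
    have i5 : Integrable fun z => pot a ((w + h).rep z) - pot a (w.rep z) :=
      (ha.integrable_pot _).sub (ha.integrable_pot _)
    rw [e, ← integral_sub (ha.integrable_pot _) (ha.integrable_pot _), ← integral_sub i5 i3,
      Real.norm_of_nonneg (sq_nonneg _)]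
    have i4 : Integrable fun z => α⁻¹ / 2 * h.rep z ^ 2 :=
      h.memLp_rep.integrable_sq.const_mul _
    refine (norm_integral_le_of_norm_le i4 (Eventually.of_forall fun z => ?_)).trans ?_
    · have := ha.abs_pot_sub_le (w.rep z) ((w + h).rep z)
      rw [H1.rep_add, Pi.add_apply, add_sub_cancel_left] at this
      rw [H1.rep_add, Pi.add_apply, hV]
      exact this
    · rw [integral_const_mul]
      have h1 : ∫ z, h.rep z ^ 2 = ‖H1.fnL h‖ ^ 2 := by
        rw [← real_inner_self_eq_norm_sq, H1.inner_fnL]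
        simp only [pow_two]
      rw [h1]
      have := inv_pos.2 ha.pos
      gcongr
      exact H1.norm_fnL_le h
  refine hO.trans_isLittleO ?_
  have := (Asymptotics.isLittleO_norm_pow_id (E' := H1) one_lt_two)
  simpa using this

/-- The flow direction is tangent to the energy levels. -/
theorem inner_velocity_eq_zero {w V : H1}
    (hV' : V.wderiv =ᵐ[volume] fun z => (a (w.rep z))⁻¹ * w.wderiv z) :
    inner ℝ (H1.derivL w) (H1.derivL (ha.velocity w))
      + inner ℝ (H1.fnL V) (H1.fnL (ha.velocity w)) = 0 := by
  -- V plays the role of Φ'(w), with V_z = w_z / a(w). In the leading term a cancels, and the source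
  -- pairs to (1 - 1/a(w)) w_z, an exact derivative of integral zero.
  have h := ha.isWeakSolution_velocity w V
  have h1 : inner ℝ (mulL (ha.bcf w) (H1.derivL (ha.velocity w))) (H1.derivL V)
      = inner ℝ (H1.derivL w) (H1.derivL (ha.velocity w)) := by
    rw [inner_mulL, L2.inner_eq_integral]
    refine integral_congr_ae ?_
    filter_upwards [hV'] with z hz
    rw [← H1.wderiv_eq V, hz, ← H1.wderiv_eq w]
    have : ha.bcf w z = a (w.rep z) := rfl
    have := (ha.pos' (w.rep z)).ne'
    rw [‹ha.bcf w z = a (w.rep z)›]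
    field_simp
  have h2 : inner ℝ (ha.source w) (H1.derivL V) = 0 := by
    have hq : Continuous fun s => 1 - (a s)⁻¹ := continuous_const.sub ha.continuous_inv
    obtain ⟨W, -, hW'⟩ := w.exists_comp (k := fun x => ∫ r in (0 : ℝ)..x, (1 - (a r)⁻¹))
      (hasDerivAt_integral_of_continuous hq 0) hq intervalIntegral.integral_same
    have hae : (fun z => ha.source w z * H1.derivL V z) =ᵐ[volume] W.wderiv := by
      filter_upwards [hW', hV', ha.source_ae_eq w] with z h1 h2 h3
      rw [h1, h3, ← H1.wderiv_eq V, h2]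
      have := (ha.pos' (w.rep z)).ne'
      field_simp
    rw [L2.inner_eq_integral, integral_congr_ae hae]
    exact W.isPrimitive_rep.integral_eq_zero ((L2.integrable_mul _ _).congr hae) two_ne_zero
      ENNReal.ofNat_ne_top W.memLp_rep
  rw [h1, h2] at h
  rw [real_inner_comm (H1.fnL (ha.velocity w))]
  exact h

/-- The cutoff only rescales the velocity, so the direction stays tangent to the energy levels even
where the cutoff is active. -/
theorem energy_eq_of_hasDerivAt {R : ℝ} {w : ℝ → H1}
    (hw : ∀ t, HasDerivAt w (ha.field R (w t)) t) (t : ℝ) : energy a (w t) = energy a (w 0) := by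
  have hd : ∀ t, HasDerivAt (fun t => energy a (w t)) 0 t := by
    intro t
    obtain ⟨V, hV, hV'⟩ := ha.exists_potDeriv_comp (w t)
    have h1 : HasDerivAt (fun t => H1.derivL (w t)) (H1.derivL (ha.field R (w t))) t :=
      H1.derivL.hasFDerivAt.comp_hasDerivAt t (hw t)
    have h2 := (ha.hasFDerivAt_integral_pot hV).comp_hasDerivAt t (hw t)
    have h3 := (h1.norm_sq.div_const 2).add h2
    have h4 := ha.inner_velocity_eq_zero hV'
    convert! h3 using 1
    simp only [field, map_smul, inner_smul_right, ContinuousLinearMap.comp_apply, innerSL_apply_apply,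
      smul_eq_mul]
    linear_combination -(cutoff R ‖w t‖) * h4
  exact is_const_of_deriv_eq_zero (fun t => (hd t).differentiableAt) (fun t => (hd t).deriv) t 0

/-- Here Φ(s) ≥ s²/(2β) because 1/a ≥ 1/β, and β ≥ 1 absorbs the gradient part. This supplies the
radius beyond which the cutoff may act. -/
theorem norm_sq_le_energy (w : H1) : ‖w‖ ^ 2 ≤ 2 * β * energy a w := by
  have hβ := zero_lt_one.trans_le ha.one_le_beta
  have h1 : β⁻¹ / 2 * ‖H1.fnL w‖ ^ 2 ≤ ∫ z, pot a (w.rep z) := by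
    rw [← real_inner_self_eq_norm_sq, H1.inner_fnL, ← integral_const_mul]
    refine integral_mono ((w.memLp_rep.integrable_mul w.memLp_rep).const_mul _)
      (ha.integrable_pot w) fun z => ?_
    have := ha.le_pot (w.rep z)
    change β⁻¹ / 2 * (w.rep z * w.rep z) ≤ _
    linarith
  have h2 : ‖H1.fnL w‖ ^ 2 ≤ 2 * β * ∫ z, pot a (w.rep z) := by
    have := mul_le_mul_of_nonneg_left h1 (by positivity : 0 ≤ 2 * β)
    calc _ = 2 * β * (β⁻¹ / 2 * ‖H1.fnL w‖ ^ 2) := by field_simp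
      _ ≤ _ := this
  rw [H1.norm_sq_eq, energy]
  nlinarith [ha.one_le_beta, sq_nonneg ‖H1.derivL w‖]

theorem hasDerivAt_barrier (s : ℝ) : HasDerivAt (barrier a) (√(2 * pot a s)) s :=
  hasDerivAt_integral_of_continuous (continuous_const.mul ha.continuous_pot).sqrt 0 s

theorem monotone_barrier : Monotone (barrier a) :=
  monotone_of_deriv_nonneg (fun s => (ha.hasDerivAt_barrier s).differentiableAt) fun s => by
    rw [(ha.hasDerivAt_barrier s).deriv]; positivity

/-- Modica-Mortola: G(w) vanishes at infinity and its derivative obeys √(2Φ(w))|w_z| ≤ w_z²/2 +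
Φ(w), whose integral is the energy. -/
theorem abs_barrier_le_energy (w : H1) (x : ℝ) : |barrier a (w.rep x)| ≤ energy a w := by
  obtain ⟨V, hV, hV'⟩ := w.exists_comp ha.hasDerivAt_barrier
    (continuous_const.mul ha.continuous_pot).sqrt intervalIntegral.integral_same
  have i1 : Integrable fun z => w.wderiv z ^ 2 / 2 + pot a (w.rep z) :=
    (w.memLp_wderiv.integrable_sq.div_const 2).add (ha.integrable_pot w)
  have hb : ∀ᵐ z, |V.wderiv z| ≤ w.wderiv z ^ 2 / 2 + pot a (w.rep z) := by
    filter_upwards [hV'] with z hz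
    have h0 : 0 ≤ 2 * pot a (w.rep z) := by linarith [ha.pot_nonneg (w.rep z)]
    have h1 := Real.sq_sqrt h0
    rw [hz, abs_mul, abs_of_nonneg (Real.sqrt_nonneg _)]
    nlinarith [sq_nonneg (√(2 * pot a (w.rep z)) - |w.wderiv z|), sq_abs (w.wderiv z)]
  have hi : Integrable V.wderiv := i1.mono' V.memLp_wderiv.1 hb
  have h1 := V.isPrimitive_rep.abs_le hi two_ne_zero ENNReal.ofNat_ne_top V.memLp_rep x
  rw [hV] at h1
  refine h1.trans ((integral_mono_ae hi.abs i1 hb).trans (le_of_eq ?_))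
  rw [integral_add (w.memLp_wderiv.integrable_sq.div_const 2) (ha.integrable_pot w),
    integral_div, energy, L2.norm_sq_eq_integral]
  rfl

end IsCoeff

/-! ### The truncated power: bounds on potential, barrier and energy -/

/-- The coefficient `(1 + s)ⁿ` with `1 + s` truncated to `[c, M]`. -/
def truncPow (n c M s : ℝ) : ℝ := max c (min M (1 + s)) ^ n

section truncPow

variable {n c M : ℝ}

theorem truncPow_eq {s : ℝ} (h1 : c ≤ 1 + s) (h2 : 1 + s ≤ M) :
    truncPow n c M s = (1 + s) ^ n := by
  rw [truncPow, min_eq_right h2, max_eq_right h1]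

theorem isCoeff_truncPow (hn : 1 ≤ n) (hc : 0 < c) (hc1 : c ≤ 1) (hM : 1 ≤ M) :
    IsCoeff (truncPow n c M) (c ^ n) (M ^ n) (n * M ^ (n - 1)) where
  pos := Real.rpow_pos_of_pos hc n
  lower s := Real.rpow_le_rpow hc.le (le_max_left _ _) (by linarith)
  upper s := Real.rpow_le_rpow (hc.le.trans (le_max_left _ _))
    (max_le (hc1.trans hM) (min_le_left _ _)) (by linarith)
  lip s t := by
    have hmem : ∀ s, max c (min M (1 + s)) ∈ Icc c M := fun s =>
      ⟨le_max_left _ _, max_le (hc1.trans hM) (min_le_left _ _)⟩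
    have h1 := (convex_Icc c M).norm_image_sub_le_of_norm_hasDerivWithin_le
      (f := fun x => x ^ n) (f' := fun x => n * x ^ (n - 1)) (C := n * M ^ (n - 1))
      (fun x hx => (Real.hasDerivAt_rpow_const (Or.inr hn)).hasDerivWithinAt)
      (fun x hx => by
        have hx0 : 0 < x := hc.trans_le hx.1
        rw [Real.norm_of_nonneg (by positivity)]
        have := Real.rpow_le_rpow hx0.le hx.2 (by linarith : 0 ≤ n - 1)
        gcongr) (hmem t) (hmem s)
    refine h1.trans ?_
    have h2 : |max c (min M (1 + s)) - max c (min M (1 + t))| ≤ |s - t| := by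
      refine (abs_max_sub_max_le_max _ _ _ _).trans (max_le (by simp) ?_)
      refine (abs_min_sub_min_le_max _ _ _ _).trans (max_le (by simp) ?_)
      simp
    have h3 : 0 ≤ M ^ (n - 1) := Real.rpow_nonneg (by linarith) _
    exact mul_le_mul_of_nonneg_left h2 (by positivity)
  map_zero := by
    rw [truncPow_eq (by linarith) (by linarith), add_zero, Real.one_rpow]

theorem rpow_le_truncPow (hn : 1 ≤ n) {x s : ℝ} (hx : 0 ≤ x) (hxM : x ≤ M) (hs : x ≤ 1 + s) :
    x ^ n ≤ truncPow n c M s :=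
  Real.rpow_le_rpow hx (le_max_of_le_right (le_min hxM hs)) (by linarith)

theorem truncPow_le_rpow (hn : 1 ≤ n) (hc : 0 < c) {x s : ℝ} (hcx : c ≤ x) (hs : 1 + s ≤ x) :
    truncPow n c M s ≤ x ^ n :=
  Real.rpow_le_rpow (hc.le.trans (le_max_left _ _)) (max_le hcx ((min_le_right _ _).trans hs))
    (by linarith)

/-- Near the degeneracy the potential is at least of order `φ⁻²`; this needs `n ≥ 4`. -/
theorem le_sqrt_pot_truncPow (hn : 4 ≤ n) (hc : 0 < c) (hc1 : c ≤ 1) (hM : 1 ≤ M) {s : ℝ}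
    (h1 : c ≤ 1 + s) (h2 : 1 + s ≤ 1 / 2) :
    (2 ^ n)⁻¹ * (1 + s)⁻¹ ≤ √(2 * IsCoeff.pot (truncPow n c M) s) := by
  have ha := isCoeff_truncPow (by linarith : 1 ≤ n) hc hc1 hM
  set φ := 1 + s with hφ
  have hφ0 : 0 < φ := hc.trans_le h1
  -- Expand about porosity 2φ ≤ 1. There Φ ≥ 0, and Φ' ≤ 0 makes the linear term nonnegative;
  -- between φ and 2φ the coefficient is at most (2φ)ⁿ, so 2Φ ≥ (2φ)⁻ⁿ φ².
  obtain ⟨d, hd, h⟩ := ha.exists_pot_eq (2 * φ - 1) s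
  rw [uIcc_of_ge (by linarith)] at hd
  have e1 : s - (2 * φ - 1) = -φ := by linarith
  have e2 := ha.potDeriv_nonpos (s := 2 * φ - 1) (by linarith)
  have e3 := ha.pot_nonneg (2 * φ - 1)
  have e4 : truncPow n c M d ≤ (2 * φ) ^ n :=
    truncPow_le_rpow (by linarith) hc (by linarith) (by linarith [hd.2])
  have e5 := inv_anti₀ (ha.pos' d) e4
  have e6 : φ ^ n ≤ φ ^ (4 : ℕ) := by
    rw [← Real.rpow_natCast]
    exact Real.rpow_le_rpow_of_exponent_ge hφ0 (by linarith) (by exact_mod_cast hn)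
  have h2n : (1 : ℝ) ≤ 2 ^ n := Real.one_le_rpow (by norm_num) (by linarith)
  have hφn : 0 < φ ^ n := Real.rpow_pos_of_pos hφ0 n
  rw [e1] at h
  have e7 : ((2 * φ) ^ n)⁻¹ * φ ^ 2 ≤ 2 * IsCoeff.pot (truncPow n c M) s := by
    nlinarith [mul_le_mul_of_nonneg_right e5 (sq_nonneg φ), mul_nonneg_of_nonpos_of_nonpos e2
      (by linarith : -φ ≤ 0)]
  refine Real.le_sqrt_of_sq_le (le_trans ?_ e7)
  rw [Real.mul_rpow (by norm_num) hφ0.le, mul_pow, inv_pow, inv_pow, mul_inv]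
  have e8 : ((2 ^ n) ^ 2)⁻¹ ≤ ((2 : ℝ) ^ n)⁻¹ := inv_anti₀ (by linarith) (by nlinarith)
  have e9 : (φ ^ 2)⁻¹ ≤ (φ ^ n)⁻¹ * φ ^ 2 := by
    rw [inv_mul_eq_div, le_div_iff₀ hφn, inv_mul_le_iff₀ (by positivity)]
    linarith
  rw [mul_assoc]
  exact mul_le_mul e8 e9 (by positivity) (by positivity)

/-- Integrating √(2Φ) ≥ 2⁻ⁿ/φ over porosities from 2c to 1/2 gives log(1/2) - log(2c) = -log(4c),
which is unbounded as c → 0. -/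
theorem barrier_truncPow_lower (hn : 4 ≤ n) (hc : 0 < c) (hc1 : c ≤ 1 / 4) (hM : 1 ≤ M) {s : ℝ}
    (hs : 1 + s ≤ 2 * c) :
    IsCoeff.barrier (truncPow n c M) s ≤ (2 ^ n)⁻¹ * Real.log (4 * c) := by
  have ha := isCoeff_truncPow (by linarith : 1 ≤ n) hc (by linarith) hM
  refine (ha.monotone_barrier (show s ≤ 2 * c - 1 by linarith)).trans ?_
  have hd : ∀ r ∈ Icc (2 * c - 1) (-1 / 2), HasDerivAt
      (fun r => IsCoeff.barrier (truncPow n c M) r - (2 ^ n)⁻¹ * Real.log (1 + r))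
      (√(2 * IsCoeff.pot (truncPow n c M) r) - (2 ^ n)⁻¹ * (1 + r)⁻¹) r := fun r hr => by
    refine (ha.hasDerivAt_barrier r).sub (HasDerivAt.const_mul _ ?_)
    have := ((hasDerivAt_id r).const_add 1).log (by simp only [id]; linarith [hr.1])
    simpa using this
  have hmono : MonotoneOn
      (fun r => IsCoeff.barrier (truncPow n c M) r - (2 ^ n)⁻¹ * Real.log (1 + r))
      (Icc (2 * c - 1) (-1 / 2)) := by
    refine monotoneOn_of_deriv_nonneg (convex_Icc _ _)
      (fun r hr => (hd r hr).continuousAt.continuousWithinAt)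
      (fun r hr => (hd r (interior_subset hr)).differentiableAt.differentiableWithinAt)
      fun r hr => ?_
    have hr' := interior_subset hr
    rw [(hd r hr').deriv, sub_nonneg]
    exact le_sqrt_pot_truncPow hn hc (by linarith) hM (by linarith [hr'.1]) (by linarith [hr'.2])
  have h1 := hmono (left_mem_Icc.2 (by linarith)) (right_mem_Icc.2 (by linarith))
    (by linarith : 2 * c - 1 ≤ -1 / 2)
  have h2 : IsCoeff.barrier (truncPow n c M) (-1 / 2) ≤ 0 := by
    have := ha.monotone_barrier (show (-1 / 2 : ℝ) ≤ 0 by norm_num)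
    rwa [show IsCoeff.barrier (truncPow n c M) 0 = 0 from intervalIntegral.integral_same] at this
  have h3 : Real.log (4 * c) = Real.log (1 + (2 * c - 1)) - Real.log (1 + -1 / 2) := by
    rw [← Real.log_div (by linarith) (by norm_num)]
    congr 1; ring
  simp only at h1
  rw [h3, mul_sub]
  linarith

/-- On [0, 1] the coefficient is at most 2ⁿ, and Φ does not fall below Φ(1) beyond 1. The slope of G
is thus at least 2⁻ⁿ, whatever M is. -/
theorem barrier_truncPow_upper (hn : 4 ≤ n) (hc : 0 < c) (hc1 : c ≤ 1) (hM : 2 ≤ M) {s : ℝ}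
    (hs : 1 ≤ s) : (2 ^ n)⁻¹ * (s - 1) ≤ IsCoeff.barrier (truncPow n c M) s := by
  have ha := isCoeff_truncPow (by linarith : 1 ≤ n) hc hc1 (by linarith : 1 ≤ M)
  have h2n : (1 : ℝ) ≤ 2 ^ n := Real.one_le_rpow (by norm_num) (by linarith)
  have hpot : ∀ r, 1 ≤ r → (2 ^ n)⁻¹ ≤ √(2 * IsCoeff.pot (truncPow n c M) r) := by
    intro r hr
    obtain ⟨d, hd, h⟩ := ha.exists_pot_eq 0 1
    rw [uIcc_of_le zero_le_one] at hd
    rw [IsCoeff.pot_zero, IsCoeff.potDeriv_zero] at h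
    have e4 : truncPow n c M d ≤ 2 ^ n :=
      truncPow_le_rpow (by linarith) hc (by linarith) (by linarith [hd.2])
    have e5 := inv_anti₀ (ha.pos' d) e4
    obtain ⟨d', -, h'⟩ := ha.exists_pot_eq 1 r
    have e6 := ha.potDeriv_nonneg (zero_le_one' ℝ)
    have e7 := inv_pos.2 (ha.pos' d')
    have e8 : 0 ≤ IsCoeff.potDeriv (truncPow n c M) 1 * (r - 1) :=
      mul_nonneg e6 (by linarith)
    have e9 : 0 ≤ (truncPow n c M d')⁻¹ * (r - 1) ^ 2 / 2 := by positivity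
    refine Real.le_sqrt_of_sq_le ?_
    have e10 : ((2 ^ n)⁻¹) ^ 2 ≤ ((2 : ℝ) ^ n)⁻¹ := by
      exact pow_le_of_le_one (by positivity) (inv_le_one_of_one_le₀ h2n) two_ne_zero
    linarith
  have hd : ∀ r, HasDerivAt
      (fun r => IsCoeff.barrier (truncPow n c M) r - (2 ^ n)⁻¹ * r)
      (√(2 * IsCoeff.pot (truncPow n c M) r) - (2 ^ n)⁻¹) r := fun r => by
    refine (ha.hasDerivAt_barrier r).sub ?_
    simpa using (hasDerivAt_id r).const_mul ((2 ^ n)⁻¹ : ℝ)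
  have hmono : MonotoneOn
      (fun r => IsCoeff.barrier (truncPow n c M) r - (2 ^ n)⁻¹ * r) (Ici 1) := by
    refine monotoneOn_of_deriv_nonneg (convex_Ici _)
      (fun r _ => (hd r).continuousAt.continuousWithinAt)
      (fun r _ => (hd r).differentiableAt.differentiableWithinAt) fun r hr => ?_
    rw [(hd r).deriv, sub_nonneg]
    exact hpot r (interior_subset hr)
  have h1 := hmono self_mem_Ici (mem_Ici.2 hs) hs
  have h2 : 0 ≤ IsCoeff.barrier (truncPow n c M) 1 := by
    have := ha.monotone_barrier (zero_le_one' ℝ)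
    rwa [show IsCoeff.barrier (truncPow n c M) 0 = 0 from intervalIntegral.integral_same] at this
  simp only at h1
  linarith

/-- The energy of data bounded in `H¹` and bounded below, independently of the truncation. -/
theorem energy_truncPow_le (hn : 1 ≤ n) (hc : 0 < c) (hM : 1 ≤ M) {k R : ℝ} (hk : 0 < k)
    (hk1 : k ≤ 1) (hc1 : c ≤ 1) {w : H1} (hw : ‖w‖ ≤ R) (hkw : ∀ z, k ≤ 1 + w.rep z) :
    IsCoeff.energy (truncPow n c M) w ≤ (1 + (k ^ n)⁻¹) * R ^ 2 := by
  have ha := isCoeff_truncPow hn hc hc1 hM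
  have hkn : 0 < (k ^ n)⁻¹ := inv_pos.2 (Real.rpow_pos_of_pos hk n)
  have h1 : ∫ z, IsCoeff.pot (truncPow n c M) (w.rep z) ≤ (k ^ n)⁻¹ * ‖H1.fnL w‖ ^ 2 := by
    rw [← real_inner_self_eq_norm_sq, H1.inner_fnL, ← integral_const_mul]
    refine integral_mono (ha.integrable_pot w)
      ((w.memLp_rep.integrable_mul w.memLp_rep).const_mul _) fun z => ?_
    obtain ⟨d, hd, h⟩ := ha.exists_pot_eq 0 (w.rep z)
    rw [IsCoeff.pot_zero, IsCoeff.potDeriv_zero] at h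
    have hd1 : k ≤ 1 + d := by
      rcases le_total 0 (w.rep z) with h0 | h0
      · rw [uIcc_of_le h0] at hd; linarith [hd.1]
      · rw [uIcc_of_ge h0] at hd; linarith [hd.1, hkw z]
    have e4 : k ^ n ≤ truncPow n c M d := rpow_le_truncPow hn hk.le (hk1.trans hM) hd1
    have e5 := inv_anti₀ (Real.rpow_pos_of_pos hk n) e4
    change IsCoeff.pot (truncPow n c M) (w.rep z) ≤ (k ^ n)⁻¹ * (w.rep z * w.rep z)
    rw [h]
    nlinarith [mul_le_mul_of_nonneg_right e5 (sq_nonneg (w.rep z)),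
      mul_nonneg hkn.le (sq_nonneg (w.rep z))]
  have h2 := pow_le_pow_left₀ (norm_nonneg _) ((H1.norm_fnL_le w).trans hw) 2
  have h3 := pow_le_pow_left₀ (norm_nonneg _) ((H1.norm_derivL_le w).trans hw) 2
  rw [IsCoeff.energy]
  nlinarith [mul_le_mul_of_nonneg_left h2 hkn.le, sq_nonneg ‖H1.derivL w‖]

end truncPow

/-- Truncation levels for which the energy bound keeps `1 + w` strictly between the levels. -/
theorem exists_truncation {n : ℝ} (hn : 4 ≤ n) {E : ℝ} (hE : 0 ≤ E) :
    ∃ c M : ℝ, 0 < c ∧ c ≤ 1 ∧ 1 ≤ M ∧ ∀ w : H1, IsCoeff.energy (truncPow n c M) w ≤ E →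
      ∀ z, 2 * c ≤ 1 + w.rep z ∧ 1 + w.rep z ≤ M - 1 := by
  have h2n : (1 : ℝ) ≤ 2 ^ n := Real.one_le_rpow (by norm_num) (by linarith)
  have hp : (0 : ℝ) ≤ 2 ^ n * (E + 1) := by positivity
  have hexp : Real.exp (-(2 ^ n * (E + 1))) ≤ 1 := Real.exp_le_one_iff.2 (by linarith)
  have hc0 : 0 < Real.exp (-(2 ^ n * (E + 1))) / 4 := by positivity
  -- The choice makes 2⁻ⁿ log(4c) = -(E + 1), and 1 + w > M - 1 forces G(w) ≥ E + 1; either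
  -- contradicts |G(w)| ≤ E.
  refine ⟨Real.exp (-(2 ^ n * (E + 1))) / 4, 3 + 2 ^ n * (E + 1), hc0, by linarith,
    by linarith, fun w hw z => ?_⟩
  have ha := isCoeff_truncPow (n := n) (M := 3 + 2 ^ n * (E + 1)) (by linarith) hc0
    (by linarith) (by linarith)
  have hb := abs_le.1 ((ha.abs_barrier_le_energy w z).trans hw)
  constructor
  · by_contra hlt
    push Not at hlt
    have := barrier_truncPow_lower (M := 3 + 2 ^ n * (E + 1)) hn hc0 (by linarith)
      (by linarith) hlt.le
    rw [mul_div_cancel₀ _ (by norm_num), Real.log_exp, mul_neg, inv_mul_cancel_left₀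
      (by linarith)] at this
    linarith [hb.1]
  · by_contra hlt
    push Not at hlt
    have := barrier_truncPow_upper (c := Real.exp (-(2 ^ n * (E + 1))) / 4)
      (M := 3 + 2 ^ n * (E + 1)) hn hc0 (by linarith) (by linarith)
      (s := w.rep z) (by linarith)
    have h3 : (2 ^ n)⁻¹ * (2 ^ n * (E + 1)) ≤ (2 ^ n)⁻¹ * (w.rep z - 1) :=
      mul_le_mul_of_nonneg_left (by linarith) (by positivity)
    rw [inv_mul_cancel_left₀ (by linarith)] at h3
    linarith [hb.2]

/-! ### From the essential supremum of 1/φ to pointwise bounds -/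

theorem H1.exists_abs_rep_lt (w : H1) {ε : ℝ} (hε : 0 < ε) : ∃ z, |w.rep z| < ε := by
  by_contra! h
  have h2 := w.memLp_rep.meas_ge_lt_top two_ne_zero ENNReal.ofNat_ne_top (ε := ⟨ε, hε.le⟩)
    (fun h0 => hε.ne' (congrArg NNReal.toReal h0))
  have h3 := (measure_mono (μ := volume) (fun z _ => h z : univ ⊆ _)).trans_lt h2
  rw [Real.volume_univ] at h3
  exact lt_irrefl _ h3

/-- The hypothesis bounds only |φ| from below, first almost everywhere and then everywhere by
continuity. A negative value would force a zero by the intermediate value theorem, since w is small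
somewhere. The maximum with 1 covers nonpositive K. -/
theorem le_one_add_rep_of_invSup_le {w : H1} {K : ℝ} (h : invSup w ≤ ENNReal.ofReal K) (z : ℝ) :
    (max K 1)⁻¹ ≤ 1 + w.rep z := by
  have hK : 0 < max K 1 := lt_max_of_lt_right one_pos
  have hcont : Continuous fun z => 1 + w.rep z := continuous_const.add w.continuous_rep
  have hae : ∀ᵐ z, (max K 1)⁻¹ ≤ |1 + w.rep z| := by
    filter_upwards [ENNReal.ae_le_essSup fun z => ‖porosity w z‖ₑ⁻¹, w.rep_ae_eq] with z hz hrep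
    have h1 : ‖porosity w z‖ₑ⁻¹ ≤ ENNReal.ofReal (max K 1) :=
      (hz.trans h).trans (ENNReal.ofReal_le_ofReal (le_max_left _ _))
    rw [ENNReal.inv_le_iff_inv_le, ← ENNReal.ofReal_inv_of_pos hK, Real.enorm_eq_ofReal_abs,
      ENNReal.ofReal_le_ofReal_iff (abs_nonneg _)] at h1
    rwa [hrep]
  have hall : ∀ z, (max K 1)⁻¹ ≤ |1 + w.rep z| := by
    have hcl : IsClosed {z | (max K 1)⁻¹ ≤ |1 + w.rep z|} := isClosed_le continuous_const hcont.abs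
    have hd : Dense {z | (max K 1)⁻¹ ≤ |1 + w.rep z|} := Measure.dense_of_ae hae
    intro z
    have := hcl.closure_eq ▸ hd z
    exact this
  have hKi : 0 < (max K 1)⁻¹ := inv_pos.2 hK
  rcases le_abs.1 (hall z) with h0 | h0
  · exact h0
  · obtain ⟨y, hy⟩ := w.exists_abs_rep_lt one_pos
    have hy' := abs_lt.1 hy
    obtain ⟨x, hx⟩ := mem_range_of_exists_le_of_exists_ge hcont (c := 0)
      ⟨z, by linarith⟩ ⟨y, by linarith [hy'.1]⟩
    have := hall x
    simp only at hx
    rw [hx, abs_zero] at this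
    linarith

theorem invSup_le_of_le_one_add_rep {w : H1} {k : ℝ} (hk : 0 < k) (h : ∀ z, k ≤ 1 + w.rep z) :
    invSup w ≤ ENNReal.ofReal k⁻¹ := by
  refine essSup_le_of_ae_le _ ?_
  filter_upwards [w.rep_ae_eq] with z hz
  rw [ENNReal.ofReal_inv_of_pos hk, ENNReal.inv_le_inv, Real.enorm_eq_ofReal_abs, porosity, ← hz]
  exact ENNReal.ofReal_le_ofReal ((h z).trans (le_abs_self _))

/-! ### Global solutions versus the truncated flow -/

section flow

variable {n c M α β Λ ρ : ℝ}

/-- Within the bounds neither the truncation nor the cutoff acts, so the field is the true velocity;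
for m = 0 it serves as both `u` and `q`. -/
theorem isGlobalSolution_of_flow (ha : IsCoeff (truncPow n c M) α β Λ) (hc : 0 < c)
    (hρ : 0 ≤ ρ) {w : ℝ → H1} (hw : ∀ t, HasDerivAt w (ha.field ρ (w t)) t)
    (hbd : ∀ t z, c ≤ 1 + (w t).rep z ∧ 1 + (w t).rep z ≤ M) (hnorm : ∀ t, ‖w t‖ ≤ ρ) :
    IsGlobalSolution n 0 (w 0) w := by
  obtain ⟨K, hK⟩ := ha.exists_lipschitzWith_field hρ
  have hwc : Continuous w := continuous_iff_continuousAt.2 fun t => (hw t).continuousAt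
  have hfc : Continuous fun t => ha.field ρ (w t) := hK.continuous.comp hwc
  refine ⟨fun t _ => ?_, ?_, fun t => ha.field ρ (w t), fun t => ha.field ρ (w t),
    fun t _ => ?_, fun t _ => ?_, fun t _ => hfc.intervalIntegrable _ _, fun t _ => ?_⟩
  · filter_upwards [(w t).rep_ae_eq] with z hz
    rw [porosity, ← hz]
    exact hc.trans_le (hbd t z).1
  · refine ContDiff.contDiffOn (contDiff_one_iff_deriv.2 ⟨fun t => (hw t).differentiableAt, ?_⟩)
    rwa [funext fun t => (hw t).deriv]
  · simp only
    rw [isEllipticSolution_iff ha fun z => (truncPow_eq (hbd t z).1 (hbd t z).2).symm,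
      ha.field_eq (hnorm t)]
    exact ha.isWeakSolution_velocity _
  · refine Eventually.of_forall fun z => ?_
    simp
  · rw [intervalIntegral.integral_eq_sub_of_hasDerivAt (fun s _ => hw s)
      (hfc.intervalIntegrable _ _)]
    abel

/-- A global solution agrees with the truncated flow as long as the latter stays away from the
truncation levels. -/
theorem IsGlobalSolution.eq_flow (ha : IsCoeff (truncPow n c M) α β Λ) (hc : 0 < c)
    (hc1 : c ≤ 1) (hρ : 0 ≤ ρ) {w v : ℝ → H1}
    (hw : ∀ t, HasDerivAt w (ha.field (ρ + 1) (w t)) t)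
    (hbd : ∀ t z, 2 * c ≤ 1 + (w t).rep z ∧ 1 + (w t).rep z ≤ M - 1) (hnorm : ∀ t, ‖w t‖ ≤ ρ)
    (hv : IsGlobalSolution n 0 (w 0) v) (T : ℝ) (hT : 0 ≤ T) : v T = w T := by
  obtain ⟨K, hK⟩ := ha.exists_lipschitzWith_field (by linarith : 0 ≤ ρ + 1)
  obtain ⟨u, q, hell, hqu, hqi, hint⟩ := hv.fixedPoint
  have hwc : Continuous w := continuous_iff_continuousAt.2 fun t => (hw t).continuousAt
  have hvc : ContinuousOn v (Ici 0) := hv.contDiffOn.continuousOn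
  -- The margins 2c, M - 1 and ρ + 1 are used here: an H¹ distance of at most c ≤ 1 from the flow
  -- keeps v inside the truncation levels and the cutoff radius.
  have hq : ∀ t s, 0 ≤ s → ‖v s - w t‖ ≤ c → q s = ha.field (ρ + 1) (v s) := by
    intro t s hs hvs
    have h1 : ∀ z, c ≤ 1 + (v s).rep z ∧ 1 + (v s).rep z ≤ M := fun z => by
      have e1 := abs_le.1 (((v s - w t).abs_rep_le z).trans hvs)
      rw [H1.rep_sub, Pi.sub_apply] at e1
      have e2 := hbd t z
      exact ⟨by linarith [e1.1], by linarith [e1.2]⟩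
    have h2 : ‖v s‖ ≤ ρ + 1 := by
      have := norm_add_le (v s - w t) (w t)
      rw [sub_add_cancel] at this
      linarith [hnorm t]
    have h3 := (isEllipticSolution_iff ha fun z =>
      (truncPow_eq (h1 z).1 (h1 z).2).symm).1 (hell s hs)
    rw [ha.field_eq h2, ← IsCoeff.IsWeakSolution.eq_velocity ha h3]
    refine H1.ext_fn ?_
    filter_upwards [hqu s hs] with z hz
    rw [hz, Real.rpow_zero, one_mul]
  have hstep : ∀ t, 0 ≤ t → v t = w t → ∃ ε > 0, ∀ s ∈ Icc t (t + ε), v s = w s := by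
    intro t ht hvt
    obtain ⟨δ, hδ, hball⟩ := Metric.continuousOn_iff.1 hvc t ht c hc
    have hε : 0 < δ / 2 := half_pos hδ
    have hnear : ∀ s ∈ Icc t (t + δ / 2), ‖v s - w t‖ ≤ c := fun s hs => by
      rw [← hvt, ← dist_eq_norm]
      refine (hball s (ht.trans hs.1) ?_).le
      rw [Real.dist_eq, abs_of_nonneg (by linarith [hs.1])]
      linarith [hs.2]
    have hle : t ≤ t + δ / 2 := by linarith
    -- Freezing v outside the short interval makes the integrand continuous on all of ℝ, so its
    -- integral is differentiable everywhere.
    let p : ℝ → H1 := fun r => v (projIcc t (t + δ / 2) hle r)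
    have hp : Continuous p := hvc.comp_continuous
      (continuous_subtype_val.comp continuous_projIcc) fun r =>
        ht.trans (projIcc t (t + δ / 2) hle r).2.1
    have hpv : ∀ r ∈ Icc t (t + δ / 2), p r = v r := fun r hr => by
      simp only [p, projIcc_of_mem hle hr]
    have hFp : Continuous fun r => ha.field (ρ + 1) (p r) := hK.continuous.comp hp
    have hW : ∀ s, HasDerivAt (fun s => v t + ∫ r in t..s, ha.field (ρ + 1) (p r))
        (ha.field (ρ + 1) (p s)) s := fun s =>
      (hasDerivAt_integral_of_continuous hFp t s).const_add _
    have hvW : ∀ s ∈ Icc t (t + δ / 2), v s = v t + ∫ r in t..s, ha.field (ρ + 1) (p r) := by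
      intro s hs
      have h0 : ∫ r in t..s, ha.field (ρ + 1) (p r) = ∫ r in t..s, q r := by
        refine intervalIntegral.integral_congr fun r hr => ?_
        rw [uIcc_of_le hs.1] at hr
        have hr' : r ∈ Icc t (t + δ / 2) := ⟨hr.1, hr.2.trans hs.2⟩
        rw [hpv r hr', hq t r (ht.trans hr.1) (hnear r hr')]
      have hs0 := ht.trans hs.1
      rw [h0, hint s hs0, hint t ht, add_assoc, intervalIntegral.integral_add_adjacent_intervals
        (hqi t ht) ((hqi t ht).symm.trans (hqi s hs0))]
    have hderiv : ∀ s ∈ Ico t (t + δ / 2),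
        HasDerivWithinAt v (ha.field (ρ + 1) (v s)) (Ici s) s := by
      intro s hs
      have h1 := (hW s).hasDerivWithinAt (s := Ici s)
      rw [hpv s (Ico_subset_Icc_self hs)] at h1
      refine h1.congr_of_eventuallyEq ?_ (hvW s (Ico_subset_Icc_self hs))
      filter_upwards [Icc_mem_nhdsGE hs.2] with r hr
      exact hvW r ⟨hs.1.trans hr.1, hr.2⟩
    refine ⟨δ / 2, hε, ODE_solution_unique_of_mem_Icc_right (v := fun _ => ha.field (ρ + 1))
      (s := fun _ => univ) (K := K) (fun _ _ => hK.lipschitzOnWith)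
      (hvc.mono fun s hs => ht.trans hs.1) hderiv (fun _ _ => mem_univ _)
      hwc.continuousOn (fun s _ => (hw s).hasDerivWithinAt) (fun _ _ => mem_univ _) hvt⟩
  have hclosed : IsClosed ({t | v t = w t} ∩ Icc 0 T) := by
    have h1 : ContinuousOn (fun t => v t - w t) (Icc 0 T) :=
      (hvc.mono Icc_subset_Ici_self).sub hwc.continuousOn
    have h2 := h1.preimage_isClosed_of_isClosed isClosed_Icc (isClosed_singleton (x := (0 : H1)))
    convert! h2 using 1
    ext t
    simp [sub_eq_zero, and_comm]
  have h0 : v 0 = w 0 := by simpa using hint 0 le_rfl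
  -- Continuous induction: the agreement set is closed, contains 0 and extends to the right of each
  -- of its points.
  refine hclosed.Icc_subset_of_forall_exists_gt h0 ?_ (right_mem_Icc.2 hT)
  rintro t ⟨htv, ht⟩ y hy
  obtain ⟨ε, hε, h⟩ := hstep t ht.1 htv
  refine ⟨min (t + ε) y, h _ ⟨le_min (by linarith) (le_of_lt hy), min_le_left _ _⟩,
    lt_min (by linarith) hy, min_le_right _ _⟩

end flow

/-- Data in a bounded class are all transported by one globally Lipschitz vector field, whose
integral curves are the only global solutions. -/
theorem exists_lipschitz_flow {n : ℝ} (hn : 4 ≤ n) (R K : ℝ) :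
    ∃ (C : ℝ≥0) (F : H1 → H1) (B : ℝ), LipschitzWith C F ∧
      ∀ w₀ : H1, ‖w₀‖ ≤ R → invSup w₀ ≤ ENNReal.ofReal K →
        ∃ w : ℝ → H1, w 0 = w₀ ∧ (∀ t, HasDerivAt w (F (w t)) t) ∧ IsGlobalSolution n 0 w₀ w ∧
          (∀ t, invSup (w t) ≤ ENNReal.ofReal B) ∧
          ∀ v : ℝ → H1, IsGlobalSolution n 0 w₀ v → ∀ t, 0 ≤ t → v t = w t := by
  have hk : 0 < (max K 1)⁻¹ := inv_pos.2 (lt_max_of_lt_right one_pos)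
  have hk1 : (max K 1)⁻¹ ≤ 1 := inv_le_one_of_one_le₀ (le_max_right _ _)
  have hE : 0 ≤ (1 + (((max K 1)⁻¹) ^ n)⁻¹) * R ^ 2 := by
    have := inv_pos.2 (Real.rpow_pos_of_pos hk n)
    positivity
  obtain ⟨c, M, hc, hc1, hM, hbd⟩ := exists_truncation hn hE
  have ha := isCoeff_truncPow (by linarith : 1 ≤ n) hc hc1 hM
  set E := (1 + (((max K 1)⁻¹) ^ n)⁻¹) * R ^ 2
  have hβ := zero_lt_one.trans_le ha.one_le_beta
  -- This radius is the norm bound that the energy gives with β = Mⁿ; the cutoff is placed one unit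
  -- further out.
  have hρ : 0 ≤ √(2 * M ^ n * E) := Real.sqrt_nonneg _
  obtain ⟨C, hC⟩ := ha.exists_lipschitzWith_field (by linarith : 0 ≤ √(2 * M ^ n * E) + 1)
  refine ⟨C, ha.field (√(2 * M ^ n * E) + 1), (2 * c)⁻¹, hC, fun w₀ hw₀ hinv => ?_⟩
  obtain ⟨w, rfl, hw⟩ := ha.exists_flow (by linarith : 0 ≤ √(2 * M ^ n * E) + 1) w₀
  have henergy : ∀ t, IsCoeff.energy (truncPow n c M) (w t) ≤ E := fun t => by
    rw [ha.energy_eq_of_hasDerivAt hw]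
    exact energy_truncPow_le (by linarith) hc hM hk hk1 hc1 hw₀ (le_one_add_rep_of_invSup_le hinv)
  have hbd' := fun t => hbd (w t) (henergy t)
  have hnorm : ∀ t, ‖w t‖ ≤ √(2 * M ^ n * E) := fun t => by
    refine Real.le_sqrt_of_sq_le ((ha.norm_sq_le_energy (w t)).trans ?_)
    exact mul_le_mul_of_nonneg_left (henergy t) (by positivity)
  refine ⟨w, rfl, hw, ?_, fun t => ?_, fun v hv t ht => ?_⟩
  · refine isGlobalSolution_of_flow ha hc (by linarith) hw (fun t z => ?_)
      fun t => (hnorm t).trans (by linarith)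
    exact ⟨by linarith [(hbd' t z).1], by linarith [(hbd' t z).2]⟩
  · exact invSup_le_of_le_one_add_rep (by linarith) fun z => (hbd' t z).1
  · exact hv.eq_flow ha hc hc1 hρ hw hbd' hnorm t ht

end Magma

end

theorem mainTheorem7 (n : ℝ) (hn4 : 4 ≤ n) (hn6 : n < 6) :
    -- existence and uniqueness of a global solution, with a lower bound uniform in time
    (∀ w₀ : Magma.H1, Magma.invSup w₀ < ⊤ →
      ∃ w : ℝ → Magma.H1, Magma.IsGlobalSolution n 0 w₀ w ∧
        (∃ K : ℝ, ∀ t, 0 ≤ t → Magma.invSup (w t) ≤ ENNReal.ofReal K) ∧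
        ∀ v : ℝ → Magma.H1, Magma.IsGlobalSolution n 0 w₀ v → ∀ t, 0 ≤ t → v t = w t) ∧
    -- continuous dependence on the data
    (∀ R K : ℝ, ∃ C : ℝ, ∀ w₀ v₀ : Magma.H1,
      ‖w₀‖ ≤ R → Magma.invSup w₀ ≤ ENNReal.ofReal K →
      ‖v₀‖ ≤ R → Magma.invSup v₀ ≤ ENNReal.ofReal K →
      ∀ w v : ℝ → Magma.H1,
        Magma.IsGlobalSolution n 0 w₀ w → Magma.IsGlobalSolution n 0 v₀ v →
        ∀ t, 0 ≤ t → ‖w t - v t‖ ≤ ‖w₀ - v₀‖ * Real.exp (C * t)) := by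
  refine ⟨fun w₀ hw₀ => ?_, fun R K => ?_⟩
  · obtain ⟨_, _, B, -, h⟩ := Magma.exists_lipschitz_flow hn4 ‖w₀‖ (Magma.invSup w₀).toReal
    obtain ⟨w, -, -, hw, hB, huniq⟩ := h w₀ le_rfl (ENNReal.ofReal_toReal hw₀.ne).ge
    exact ⟨w, hw, ⟨B, fun t _ => hB t⟩, huniq⟩
  · obtain ⟨C, F, _, hF, h⟩ := Magma.exists_lipschitz_flow hn4 R K
    refine ⟨C, fun w₀ v₀ hw₀ hwK hv₀ hvK w v hw hv t ht => ?_⟩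
    obtain ⟨W, rfl, hW, -, -, hWu⟩ := h w₀ hw₀ hwK
    obtain ⟨V, rfl, hV, -, -, hVu⟩ := h v₀ hv₀ hvK
    have hcont : ∀ {X : ℝ → Magma.H1}, (∀ t, HasDerivAt X (F (X t)) t) → ContinuousOn X (Icc 0 t) :=
      fun hX s _ => (hX s).continuousAt.continuousWithinAt
    -- Grönwall applies because both data lie in one class and so follow the same Lipschitz field.
    have := dist_le_of_trajectories_ODE (v := fun _ => F) (fun _ => hF) (hcont hW)
      (fun s _ => (hW s).hasDerivWithinAt) (hcont hV) (fun s _ => (hV s).hasDerivWithinAt)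
      le_rfl t (right_mem_Icc.2 ht)
    rw [sub_zero] at this
    rwa [hWu w hw t ht, hVu v hv t ht, ← dist_eq_norm, ← dist_eq_norm]
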